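/- **Theorem 1.5.** Let $d\ge 2$, and let $(F_1,\dots,F_{d-1})$ be a tuple of finite subsets of $\mathbb{Z}^d$. Write $F_i^*=F_i\setminus\{0\}$. Suppose that the tuple has property $(\star)$, that is: 1. it is an independent tuple of tiles: $0\in F_i$ for every $1\le i\le d-1$, and for every $(v_1,\dots,v_{d-1})\in F_1^*\times\dots\times F_{d-1}^*$ the vectors $v_1,\dots,v_{d-1}$ are linearly independent; and 2. whenever $(v_1,\dots,v_{d-1}),(w_1,\dots,w_{d-1})\in F_1^*\times\dots\times F_{d-1}^*$ have the same linear span in $\mathbb{R}^d$, then $v_i=w_i$ for all $1\le i\le d-2$. Let $A\subseteq\mathbb{Z}^d$ be a joint co-tile for $F_1,\dots,F_{d-1}$, that is, for every $1\le i\le d-1$, $F_i\oplus A=\mathbb{Z}^d$: each $x\in\mathbb{Z}^d$ can be written in exactly one way as $x=f+a$ with $f\in F_i$ and $a\in A$. Then $A$ is piecewise $(d-1)$-periodic: there are finitely many pairwise disjoint sets $A_1,\dots,A_r$ with $A=A_1\cup\dots\cup A_r$ such that each $A_j$ is $(d-1)$-periodic, i.e. there is a subgroup $L_j\le\mathbb{Z}^d$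 of rank at least $d-1$ with $A_j+L_j=A_j$. -/

import Mathlib

open scoped Pointwise

/-- `F ⊕ A = ℤ^d` for each tile `F` of the tuple: every element of `ℤ^d` is uniquely `f + a`
with `f ∈ F i` and `a ∈ A` (this is what `AddSubgroup.IsComplement`, a notion about arbitrary
subsets of an additive group, says). -/
def IsJointCotile {d k : ℕ} (F : Fin k → Finset (Fin d → ℤ)) (A : Set (Fin d → ℤ)) : Prop :=
  ∀ i, AddSubgroup.IsComplement (F i : Set (Fin d → ℤ)) A

/-- The choices `(v_1, …, v_k) ∈ F_1^* × ⋯ × F_k^*`, where `F^* = F \ {0}`. -/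
def starTuples {d k : ℕ} (F : Fin k → Finset (Fin d → ℤ)) : Set (Fin k → Fin d → ℤ) :=
  {v | ∀ i, v i ∈ (F i : Set (Fin d → ℤ)) \ {0}}

/-- An independent tuple of tiles. -/
def IsIndependentTuple {d k : ℕ} (F : Fin k → Finset (Fin d → ℤ)) : Prop :=
  (∀ i, 0 ∈ F i) ∧ ∀ v ∈ starTuples F, LinearIndependent ℤ v

/-- The linear span in `ℝ^d` of a tuple of integer vectors. -/
def realSpan {d k : ℕ} (v : Fin k → Fin d → ℤ) : Submodule ℝ (Fin d → ℝ) :=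
  Submodule.span ℝ (Set.range fun (i : Fin k) (j : Fin d) => (v i j : ℝ))

/-- Property `(⋆)` of a `(d-1)`-tuple of tiles in `ℤ^d`, for `d ≥ 2`. Indices start at `0`, so the
first `d - 2` entries are those with index `< d - 2`. -/
def PropertyStar {d : ℕ} (F : Fin (d - 1) → Finset (Fin d → ℤ)) : Prop :=
  IsIndependentTuple F ∧
    ∀ v ∈ starTuples F, ∀ w ∈ starTuples F, realSpan v = realSpan w →
      ∀ i : Fin (d - 1), (i : ℕ) < d - 2 → v i = w i

/-- `C` is `k`-periodic: `C + L = C` for some subgroup `L` of `ℤ^d` of rank at least `k`. -/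
def IsKPeriodic {d : ℕ} (k : ℕ) (C : Set (Fin d → ℤ)) : Prop :=
  ∃ L : AddSubgroup (Fin d → ℤ), k ≤ Module.finrank ℤ L ∧ C + (L : Set (Fin d → ℤ)) = C

/-- `A` is a disjoint union of finitely many `k`-periodic sets. -/
def IsPiecewiseKPeriodic {d : ℕ} (k : ℕ) (A : Set (Fin d → ℤ)) : Prop :=
  ∃ (r : ℕ) (B : Fin r → Set (Fin d → ℤ)),
    Pairwise (fun i j => Disjoint (B i) (B j)) ∧ (⋃ j, B j) = A ∧ ∀ j, IsKPeriodic k (B j)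

/-! Let f be the indicator of A, k = d - 1, and q the product of the tile sizes. By
`sum_translate_dilate`, A is also a co-tile for each dilate (1 + nq)F_i. Averaging this tiling
identity over n and isolating the term of 0 ∈ F_i writes a function as 1 minus a sum of its averages
along the nonzero u ∈ F_i, each invariant under qu (`iterAvg_eq_one_sub`). Using every tile once, f
becomes a constant plus (-1)^k times a sum over tuples w of functions periodic under a finite-index
subgroup of the hyperplane lattice of w.

Group these functions by hyperplane. As f is integer valued, the groups add up to a constant modulo
1. Distinct hyperplanes are transversal, so repeated differencing eliminates all groups but one, and
each group is polynomial modulo 1 along lines (`isPolySeq_of_add_sum_const`). A Weyl dichotomy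
(`IsPolySeq.periodic_or_invMean_eq_zero`) makes it constant or equidistributed modulo 1 on cosets of
a suitable M ℤ^d. By (⋆), tuples with the same hyperplane differ only in the last entry, so a group
is part of a single sum bounded by 1 and takes values in [0,1]. Hence it is truly constant on the
coset, or has infimum 0 and supremum 1 there (`constOrOsc_of_isPolySeq`).

This dichotomy climbs back through the recursion (`constOrOsc_one_sub_sum`): in a sum of nonnegative
functions bounded by 1, two fully oscillating terms with transversal periods would both be large at
a common point. So at most one term is nonconstant, and its periods are inherited. At the top of the
recursion this says that f, on each coset of some N ℤ^d, is constant or periodic along a hyperplane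
lattice. -/

open Filter Topology

/-! ### Shift-invariant means and the van der Corput lemma -/

section Mean

variable {E : Type*} [NormedAddCommGroup E] [NormedSpace ℝ E]

/-- The Cesàro averages of a sequence. -/
noncomputable def cesaro (f : ℕ → E) (N : ℕ) : E :=
  ((N : ℝ)⁻¹) • ∑ n ∈ Finset.range N, f n

/-- A shift-invariant mean: the limit of the Cesàro averages along a nonprincipal ultrafilter. -/
noncomputable def invMean (f : ℕ → E) : E :=
  limUnder (hyperfilter ℕ : Filter ℕ) (cesaro f)

lemma norm_cesaro_le {f : ℕ → E} {C : ℝ} (hf : ∀ n, ‖f n‖ ≤ C) (N : ℕ) : ‖cesaro f N‖ ≤ C := by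
  have hC : 0 ≤ C := (norm_nonneg _).trans (hf 0)
  rcases Nat.eq_zero_or_pos N with rfl | hN
  · simpa [cesaro] using hC
  have hN' : (0 : ℝ) < N := by exact_mod_cast hN
  rw [cesaro, norm_smul, norm_inv, Real.norm_natCast, inv_mul_le_iff₀ hN']
  refine (norm_sum_le _ _).trans ((Finset.sum_le_sum fun n _ => hf n).trans ?_)
  simp

variable [ProperSpace E]

/-- The averages stay in a compact ball, where every ultrafilter converges. Boundedness is therefore
what gives `invMean` meaning, and it accompanies all the rules below. -/
lemma tendsto_invMean {f : ℕ → E} {C : ℝ} (hf : ∀ n, ‖f n‖ ≤ C) :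
    Tendsto (cesaro f) (hyperfilter ℕ : Filter ℕ) (𝓝 (invMean f)) := by
  refine tendsto_nhds_limUnder ?_
  obtain ⟨x, -, hx⟩ := (isCompact_closedBall (0 : E) C).ultrafilter_le_nhds
    ((hyperfilter ℕ).map (cesaro f)) (by
      rw [le_principal_iff]
      exact Filter.mem_map.2 (Filter.univ_mem' fun N => by
        simpa using norm_cesaro_le hf N))
  exact ⟨x, hx⟩

lemma invMean_eq_of_tendsto {f : ℕ → E} {C : ℝ} (hf : ∀ n, ‖f n‖ ≤ C) {x : E}
    (h : Tendsto (cesaro f) (hyperfilter ℕ : Filter ℕ) (𝓝 x)) : invMean f = x :=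
  tendsto_nhds_unique (tendsto_invMean hf) h

lemma norm_invMean_le {f : ℕ → E} {C : ℝ} (hf : ∀ n, ‖f n‖ ≤ C) : ‖invMean f‖ ≤ C :=
  le_of_tendsto (tendsto_invMean hf).norm (Eventually.of_forall fun N => norm_cesaro_le hf N)

lemma invMean_const (c : E) : invMean (fun _ => c) = c := by
  refine invMean_eq_of_tendsto (fun _ => le_rfl) (tendsto_const_nhds.congr' ?_)
  have : ∀ᶠ N : ℕ in (hyperfilter ℕ : Filter ℕ), 0 < N :=
    (Nat.hyperfilter_le_atTop) (eventually_gt_atTop 0)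
  filter_upwards [this] with N hN
  have hN' : (N : ℝ) ≠ 0 := by exact_mod_cast hN.ne'
  simp [cesaro, ← Nat.cast_smul_eq_nsmul ℝ, smul_smul, hN']

lemma invMean_add {f g : ℕ → E} {C D : ℝ} (hf : ∀ n, ‖f n‖ ≤ C) (hg : ∀ n, ‖g n‖ ≤ D) :
    invMean (fun n => f n + g n) = invMean f + invMean g := by
  refine invMean_eq_of_tendsto (C := C + D)
    (fun n => (norm_add_le _ _).trans (add_le_add (hf n) (hg n)))
    (((tendsto_invMean hf).add (tendsto_invMean hg)).congr fun N => ?_)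
  simp [cesaro, Finset.sum_add_distrib]

lemma invMean_map {E' : Type*} [NormedAddCommGroup E'] [NormedSpace ℝ E'] [ProperSpace E']
    (T : E →L[ℝ] E') {f : ℕ → E} {C : ℝ} (hf : ∀ n, ‖f n‖ ≤ C) :
    invMean (fun n => T (f n)) = T (invMean f) := by
  refine invMean_eq_of_tendsto (C := ‖T‖ * C)
    (fun n => (T.le_opNorm _).trans (mul_le_mul_of_nonneg_left (hf n) (norm_nonneg _)))
    (((T.continuous.tendsto _).comp (tendsto_invMean hf)).congr fun N => ?_)
  simp [cesaro]

lemma invMean_sum {ι : Type*} (s : Finset ι) {f : ι → ℕ → E} {C : ι → ℝ}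
    (hf : ∀ i n, ‖f i n‖ ≤ C i) :
    invMean (fun n => ∑ i ∈ s, f i n) = ∑ i ∈ s, invMean (f i) := by
  classical
  induction s using Finset.induction_on with
  | empty => simpa using invMean_const (0 : E)
  | insert a s ha ih =>
    simp only [Finset.sum_insert ha]
    rw [invMean_add (hf a) (D := ∑ i ∈ s, C i)
      (fun n => norm_sum_le_of_le _ fun i _ => hf i n), ih]

lemma invMean_shift_one {f : ℕ → E} {C : ℝ} (hf : ∀ n, ‖f n‖ ≤ C) :
    invMean (fun n => f (n + 1)) = invMean f := by
  refine invMean_eq_of_tendsto (C := C) (fun n => hf _) ?_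
  have h0 : Tendsto (fun N : ℕ => ((N : ℝ)⁻¹) • (f N - f 0)) atTop (𝓝 0) := by
    have : Tendsto (fun N : ℕ => ((N : ℝ)⁻¹) * (C + C)) atTop (𝓝 0) := by
      simpa using (tendsto_inv_atTop_nhds_zero_nat (𝕜 := ℝ)).mul_const (C + C)
    refine squeeze_zero_norm (fun N => ?_) this
    rw [norm_smul, norm_inv, Real.norm_natCast]
    gcongr
    exact (norm_sub_le _ _).trans (add_le_add (hf _) (hf _))
  have := (tendsto_invMean hf).add (h0.mono_left Nat.hyperfilter_le_atTop)
  rw [add_zero] at this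
  refine this.congr fun N => ?_
  rw [cesaro, cesaro, ← smul_add]
  congr 1
  have := Finset.sum_range_succ' f N
  rw [Finset.sum_range_succ] at this
  rw [add_sub, this, add_sub_cancel_right]

lemma invMean_shift {f : ℕ → E} {C : ℝ} (hf : ∀ n, ‖f n‖ ≤ C) (h : ℕ) :
    invMean (fun n => f (n + h)) = invMean f := by
  induction h with
  | zero => rfl
  | succ h ih =>
    rw [← ih, ← invMean_shift_one (f := fun n => f (n + h)) (fun n => hf _)]
    simp only [add_assoc, add_comm 1 h]

end Mean

lemma invMean_nonneg {f : ℕ → ℝ} {C : ℝ} (hf : ∀ n, ‖f n‖ ≤ C) (h0 : ∀ n, 0 ≤ f n) :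
    0 ≤ invMean f :=
  ge_of_tendsto (tendsto_invMean hf) (Eventually.of_forall fun N =>
    mul_nonneg (by positivity) (Finset.sum_nonneg fun n _ => h0 n))

lemma invMean_smul {f : ℕ → ℂ} {C : ℝ} (hf : ∀ n, ‖f n‖ ≤ C) (c : ℂ) :
    invMean (fun n => c * f n) = c * invMean f :=
  invMean_map ((ContinuousLinearMap.mul ℝ ℂ) c) hf

lemma invMean_conj {f : ℕ → ℂ} {C : ℝ} (hf : ∀ n, ‖f n‖ ≤ C) :
    invMean (fun n => (starRingEnd ℂ) (f n)) = (starRingEnd ℂ) (invMean f) :=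
  invMean_map (Complex.conjCLE : ℂ →L[ℝ] ℂ) hf

/-- Expand the nonnegative mean of ‖f n - c‖², where c is the mean of f. -/
lemma norm_sq_invMean_le {f : ℕ → ℂ} {C : ℝ} (hf : ∀ n, ‖f n‖ ≤ C) :
    ‖invMean f‖ ^ 2 ≤ invMean (fun n => ‖f n‖ ^ 2) := by
  set c := invMean f with hc
  have hsq : ∀ n, ‖‖f n‖ ^ 2‖ ≤ C ^ 2 := fun n => by
    rw [norm_pow, norm_norm]
    exact pow_le_pow_left₀ (norm_nonneg _) (hf n) 2
  set T : ℂ →L[ℝ] ℝ := Complex.reCLM.comp ((ContinuousLinearMap.mul ℝ ℂ) (-2 * (starRingEnd ℂ) c))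
  have hT : ∀ z, T z = -2 * ((starRingEnd ℂ) c * z).re := fun z => by
    simp [T]; ring
  have hTb : ∀ n, ‖T (f n)‖ ≤ ‖T‖ * C := fun n =>
    (T.le_opNorm _).trans (mul_le_mul_of_nonneg_left (hf n) (norm_nonneg _))
  have key : ∀ n, ‖f n - c‖ ^ 2 = ‖f n‖ ^ 2 + (T (f n) + ‖c‖ ^ 2) := fun n => by
    rw [hT, ← Complex.normSq_eq_norm_sq, ← Complex.normSq_eq_norm_sq, ← Complex.normSq_eq_norm_sq]
    simp [Complex.normSq_apply]; ring
  have hb : ∀ n, ‖‖f n - c‖ ^ 2‖ ≤ (C + ‖c‖) ^ 2 := fun n => by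
    rw [norm_pow, norm_norm]
    exact pow_le_pow_left₀ (norm_nonneg _)
      ((norm_sub_le _ _).trans (add_le_add (hf n) le_rfl)) 2
  have h0 := invMean_nonneg hb (fun n => by positivity)
  simp only [key] at h0
  rw [invMean_add (D := ‖T‖ * C + ‖‖c‖ ^ 2‖) hsq
      (fun n => (norm_add_le _ _).trans (add_le_add (hTb n) le_rfl)),
    invMean_add (g := fun _ => ‖c‖ ^ 2) hTb (fun _ => le_rfl), invMean_map T hf, invMean_const, hT,
    ← hc] at h0
  have : ((starRingEnd ℂ) c * c).re = ‖c‖ ^ 2 := by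
    rw [mul_comm, Complex.mul_conj, Complex.normSq_eq_norm_sq]; exact Complex.ofReal_re _
  linarith

/-- The van der Corput lemma for the invariant mean. -/
lemma invMean_eq_zero_of_correlations {F : ℕ → ℂ} (hF : ∀ n, ‖F n‖ ≤ 1)
    (hc : ∀ h : ℕ, 0 < h → invMean (fun n => F (n + h) * (starRingEnd ℂ) (F n)) = 0) :
    invMean F = 0 := by
  have hprod : ∀ a b n : ℕ, ‖F (n + a) * (starRingEnd ℂ) (F (n + b))‖ ≤ 1 := fun a b n => by
    rw [norm_mul, RCLike.norm_conj]
    exact mul_le_one₀ (hF _) (norm_nonneg _) (hF _)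
  have hlt : ∀ a b : ℕ, b < a →
      invMean (fun n => F (n + a) * (starRingEnd ℂ) (F (n + b))) = 0 := by
    intro a b hab
    obtain ⟨t, rfl⟩ := Nat.exists_eq_add_of_lt hab
    have := invMean_shift (f := fun n => F (n + (t + 1)) * (starRingEnd ℂ) (F n))
      (C := 1) (fun n => hprod (t + 1) 0 n) b
    rw [hc (t + 1) t.succ_pos] at this
    rw [← this]
    congr 1; ext n; congr 2; ring_nf
  have hne : ∀ a b : ℕ, a ≠ b →
      invMean (fun n => F (n + a) * (starRingEnd ℂ) (F (n + b))) = 0 := by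
    intro a b hab
    rcases lt_or_gt_of_ne hab with h | h
    · have := invMean_conj (hprod b a)
      rw [hlt b a h, map_zero] at this
      rw [← this]
      congr 1; ext n; simp [mul_comm]
    · exact hlt a b h
  -- Replace F by its sum S over a window of length H. The mean of S is H times that of F, while in
  -- the mean of ‖S‖² only the H diagonal correlations survive.
  have main : ∀ H : ℕ, 0 < H → (H : ℝ) * ‖invMean F‖ ^ 2 ≤ 1 := by
    intro H hH
    have hH' : (0 : ℝ) < H := by exact_mod_cast hH
    set S : ℕ → ℂ := fun n => ∑ h ∈ Finset.range H, F (n + h) with hS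
    have hSb : ∀ n, ‖S n‖ ≤ H := fun n => by
      refine (norm_sum_le_of_le _ fun h _ => hF (n + h)).trans ?_
      simp
    have hSm : invMean S = H * invMean F := by
      rw [hS, invMean_sum (f := fun h n => F (n + h)) (C := fun _ => 1) _ (fun h n => hF _)]
      simp only [invMean_shift hF]
      simp
    have h1 := norm_sq_invMean_le hSb
    have hSS : (fun n => S n * (starRingEnd ℂ) (S n)) = fun n => ∑ a ∈ Finset.range H,
        ∑ b ∈ Finset.range H, F (n + a) * (starRingEnd ℂ) (F (n + b)) := by
      ext n
      rw [hS, map_sum, Finset.sum_mul_sum]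
    have h2 : invMean (fun n => S n * (starRingEnd ℂ) (S n))
        = ∑ a ∈ Finset.range H, invMean (fun n => F (n + a) * (starRingEnd ℂ) (F (n + a))) := by
      rw [hSS, invMean_sum
        (f := fun a n => ∑ b ∈ Finset.range H, F (n + a) * (starRingEnd ℂ) (F (n + b)))
        (C := fun _ => ∑ b ∈ Finset.range H, (1 : ℝ)) _
        (fun a n => norm_sum_le_of_le _ fun b _ => hprod a b n)]
      refine Finset.sum_congr rfl fun a ha => ?_
      rw [invMean_sum (f := fun b n => F (n + a) * (starRingEnd ℂ) (F (n + b)))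
        (C := fun _ => 1) _ (fun b n => hprod a b n)]
      exact Finset.sum_eq_single_of_mem a ha fun b _ hb => hne a b hb.symm
    have h3 : ‖invMean (fun n => S n * (starRingEnd ℂ) (S n))‖ ≤ H := by
      rw [h2]
      refine (norm_sum_le_of_le _ fun a _ => norm_invMean_le (hprod a a)).trans ?_
      simp
    have h4 : ((invMean (fun n => ‖S n‖ ^ 2) : ℝ) : ℂ)
        = invMean (fun n => S n * (starRingEnd ℂ) (S n)) := by
      rw [← Complex.ofRealCLM_apply, ← invMean_map Complex.ofRealCLM (C := (H : ℝ) ^ 2)]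
      · congr 1; ext n
        rw [Complex.mul_conj, Complex.normSq_eq_norm_sq]
        simp
      · intro n
        rw [norm_pow, norm_norm]
        exact pow_le_pow_left₀ (norm_nonneg _) (hSb n) 2
    have h5 : invMean (fun n => ‖S n‖ ^ 2) ≤ H := by
      refine le_trans (le_abs_self _) ?_
      rwa [← h4, Complex.norm_real, Real.norm_eq_abs] at h3
    rw [hSm, norm_mul, mul_pow, Complex.norm_natCast] at h1
    have h6 : (H : ℝ) * (H * ‖invMean F‖ ^ 2) ≤ H * 1 := by nlinarith
    exact le_of_mul_le_mul_left h6 hH'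
  by_contra hne0
  have hpos : 0 < ‖invMean F‖ ^ 2 := by positivity
  obtain ⟨H, hH⟩ := exists_nat_gt (1 / ‖invMean F‖ ^ 2)
  have hH0 : 0 < H := by
    have : (0 : ℝ) < H := lt_trans (by positivity) hH
    exact_mod_cast this
  rw [div_lt_iff₀ hpos] at hH
  exact absurd (main H hH0) (not_le.2 hH)

/-! ### Polynomial sequences in the circle and equidistribution -/

/-- `IsPolySeq m q`: the map `q` is polynomial of degree at most `m`, in the sense that all its
`m`-fold differences are constant. -/
def IsPolySeq {X : Type*} [AddCommGroup X] : ℕ → (ℤ → X) → Prop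
  | 0, q => ∀ n, q n = q 0
  | m + 1, q => ∀ h : ℤ, IsPolySeq m (fun n => q (n + h) - q n)

lemma apply_add_mul_of_periodic {Y : Type*} {q : ℤ → Y} {L : ℤ} (hs : ∀ n, q (n + L) = q n) (j : ℕ) (n : ℤ) :
    q (n + L * j) = q n := by
  induction j with
  | zero => simp
  | succ j ih => rw [Nat.cast_succ, mul_add, mul_one, ← add_assoc, hs, ih]

section Periodic

variable {X : Type*} [AddCommGroup X]

lemma apply_add_mul_of_periodic_diff {q : ℤ → X} {L : ℤ}
    (hs : ∀ n, q (n + L + L) - q (n + L) = q (n + L) - q n) (j : ℕ) (n : ℤ) :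
    q (n + L * j) = q n + j • (q (n + L) - q n) := by
  induction j with
  | zero => simp
  | succ j ih =>
    have h1 := apply_add_mul_of_periodic (q := fun n => q (n + L) - q n) (L := L) hs j n
    rw [Nat.cast_succ, mul_add, mul_one, ← add_assoc, succ_nsmul, ← add_assoc, ← ih, ← h1]
    abel

/-- A periodic polynomial map is constant up to torsion. -/
lemma IsPolySeq.exists_nsmul_sub_eq_zero {m : ℕ} {s : ℤ → X} (hs : IsPolySeq m s) {L : ℕ} (hL : 0 < L)
    (hp : ∀ n, s (n + L) = s n) : ∃ K : ℕ, 0 < K ∧ ∀ n, K • (s n - s 0) = 0 := by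
  induction m generalizing s with
  | zero => exact ⟨1, one_pos, fun n => by rw [hs n, sub_self, smul_zero]⟩
  | succ m ih =>
    obtain ⟨K, hK, h⟩ := ih (hs 1) (fun n => by rw [add_right_comm, hp, hp])
    simp only [zero_add] at h
    set c := K • (s 1 - s 0) with hc
    have h' : ∀ n, K • (s (n + 1) - s n) = c := fun n => by
      rw [hc, ← sub_eq_zero, ← smul_sub, h]
    have hnat : ∀ j : ℕ, ∀ n, K • (s (n + j) - s n) = j • c := by
      intro j
      induction j with
      | zero => intro n; simp
      | succ j ihj =>
        intro n
        have : s (n + (j + 1 : ℕ)) - s n = (s (n + j + 1) - s (n + j)) + (s (n + j) - s n) := by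
          push_cast; rw [← add_assoc]; abel
        rw [this, smul_add, h', ihj, succ_nsmul, add_comm]
    have hLc : L • c = 0 := by rw [← hnat L 0, hp, sub_self, smul_zero]
    refine ⟨L * K, Nat.mul_pos hL hK, fun n => ?_⟩
    rw [mul_smul]
    obtain ⟨j, rfl | rfl⟩ := n.eq_nat_or_neg
    · have := hnat j 0
      rw [zero_add] at this
      rw [this, smul_comm, hLc, smul_zero]
    · have := hnat j (-j)
      rw [neg_add_cancel] at this
      rw [← neg_sub, smul_neg, smul_neg, this, smul_comm, hLc, smul_zero, neg_zero]

end Periodic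

local instance fact_zero_lt_one_real : Fact ((0 : ℝ) < 1) := ⟨one_pos⟩

lemma norm_fourier_apply (k : ℤ) (x : AddCircle (1 : ℝ)) : ‖fourier k x‖ = 1 := by
  rw [fourier_apply, Circle.norm_coe]

lemma fourier_apply_add (k : ℤ) (x y : AddCircle (1 : ℝ)) :
    fourier k (x + y) = fourier k x * fourier k y := by
  simp only [fourier_apply, zsmul_add, AddCircle.toCircle_add, Circle.coe_mul]

lemma fourier_apply_sub (k : ℤ) (x y : AddCircle (1 : ℝ)) :
    fourier k (x - y) = fourier k x * (starRingEnd ℂ) (fourier k y) := by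
  have h := fourier_apply_add k (x - y) y
  rw [sub_add_cancel] at h
  rw [h, mul_assoc, Complex.mul_conj, Complex.normSq_eq_norm_sq, norm_fourier_apply]
  simp

lemma fourier_apply_eq_one_iff (k : ℤ) (x : AddCircle (1 : ℝ)) : fourier k x = 1 ↔ k • x = 0 := by
  rw [fourier_apply, Circle.coe_eq_one, ← AddCircle.toCircle_zero (T := (1 : ℝ))]
  exact (AddCircle.injective_toCircle one_ne_zero).eq_iff

/-- F is a coboundary: F n = g (n + L) - g n with g = F / (ψ - 1). This g is bounded because ψ takes
finitely many values, none equal to 1. -/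
lemma invMean_eq_zero_of_quasiperiodic {F ψ : ℕ → ℂ} {L : ℕ} (hL : 0 < L)
    (hF : ∀ n, ‖F n‖ ≤ 1) (hFψ : ∀ n, F (n + L) = F n * ψ n) (hψ : ∀ n, ψ (n + L) = ψ n)
    (hψ1 : ∀ n, ψ n ≠ 1) : invMean F = 0 := by
  have hmod : ∀ n, ψ (n % L) = ψ n := fun n => by
    have hper : Function.Periodic ψ L := hψ
    exact hper.map_mod_nat n
  set C : ℝ := ∑ n ∈ Finset.range L, ‖(ψ n - 1)⁻¹‖ with hC
  have hb : ∀ n, ‖(ψ n - 1)⁻¹‖ ≤ C := fun n => by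
    rw [← hmod n]
    exact Finset.single_le_sum (f := fun n => ‖(ψ n - 1)⁻¹‖) (fun _ _ => norm_nonneg _)
      (Finset.mem_range.2 (Nat.mod_lt n hL))
  set g : ℕ → ℂ := fun n => F n * (ψ n - 1)⁻¹ with hg
  have hgb : ∀ n, ‖g n‖ ≤ C := fun n => by
    rw [hg]
    simp only [norm_mul]
    exact (mul_le_of_le_one_left (norm_nonneg _) (hF n)).trans (hb n)
  have hadd : ∀ n, g (n + L) = F n + g n := fun n => by
    have := sub_ne_zero.2 (hψ1 n)
    simp only [hg, hFψ, hψ]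
    field_simp
    ring
  have := invMean_shift hgb L
  simp only [hadd] at this
  rw [invMean_add hF hgb] at this
  simpa using this

/-- A polynomial sequence in the circle is periodic, or all its nontrivial characters have mean
zero along every arithmetic progression. -/
lemma IsPolySeq.periodic_or_invMean_eq_zero {m : ℕ} {q : ℤ → AddCircle (1 : ℝ)} (hq : IsPolySeq m q) :
    (∃ N : ℕ, 0 < N ∧ ∀ n, q (n + N) = q n) ∨
      ∀ k : ℤ, k ≠ 0 → ∀ (a : ℤ) (M : ℕ), 0 < M →
        invMean (fun n : ℕ => fourier k (q (a + M * n))) = 0 := by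
  induction m generalizing q with
  | zero => exact Or.inl ⟨1, one_pos, fun n => by rw [hq, ← hq n]⟩
  | succ m ih =>
    -- If no difference with positive step is periodic, induction gives every difference mean-zero
    -- characters, and van der Corput applies.
    by_cases hA : ∃ h N : ℕ, 0 < h ∧ 0 < N ∧ ∀ n, q (n + N + h) - q (n + N) = q (n + h) - q n
    swap
    · right
      intro k hk a M hM
      refine invMean_eq_zero_of_correlations (fun n => (norm_fourier_apply _ _).le) fun h hh => ?_
      rcases ih (hq ((M * h : ℕ) : ℤ)) with ⟨N, hN, hper⟩ | hmean
      · exact absurd ⟨M * h, N, Nat.mul_pos hM hh, hN, fun n => hper n⟩ hA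
      · rw [← hmean k hk a M hM]
        congr 1; ext n
        rw [fourier_apply_sub]
        congr 3
        push_cast; ring_nf
    · obtain ⟨h, N, hh, hN, hper⟩ := hA
      -- With this L the L-step difference s of q is itself L-periodic, so q is affine along
      -- progressions of step L; its slope s is constant up to torsion.
      set L : ℕ := h * N with hLdef
      have hL : 0 < L := Nat.mul_pos hh hN
      set s : ℤ → AddCircle (1 : ℝ) := fun n => q (n + L) - q n with hs
      have hsN : ∀ n, s (n + N) = s n := by
        have : ∀ j : ℕ, ∀ n, q (n + N + h * j) - q (n + N) = q (n + h * j) - q n := by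
          intro j
          induction j with
          | zero => intro n; simp
          | succ j ihj =>
            intro n
            have e1 := hper (n + h * j)
            have e2 := ihj n
            have r1 : n + N + (h : ℤ) * (j + 1 : ℕ) = n + h * j + N + h := by push_cast; ring
            have r2 : n + (h : ℤ) * (j + 1 : ℕ) = n + h * j + h := by push_cast; ring
            have r3 : n + (h : ℤ) * j + N = n + N + h * j := by ring
            rw [r1, r2]
            rw [r3] at e1 ⊢
            rw [← sub_add_sub_cancel (q (n + N + h * j + h)) (q (n + N + h * j)), e1, e2]
            abel
        intro n
        simp only [hs, hLdef]
        push_cast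
        exact this N n
      have hsL : ∀ n, s (n + L) = s n := fun n => by
        have := apply_add_mul_of_periodic hsN h n
        rw [← this, hLdef]; push_cast; rw [mul_comm (h : ℤ)]
      obtain ⟨K, hK, hKs⟩ := IsPolySeq.exists_nsmul_sub_eq_zero (hq L) hL hsL
      have hKs' : ∀ n, K • s n = K • s 0 := fun n => by
        rw [← sub_eq_zero, ← smul_sub]; exact hKs n
      have hqj : ∀ (j : ℕ) (n : ℤ), q (n + L * j) = q n + j • s n :=
        apply_add_mul_of_periodic_diff hsL
      -- One torsion slope makes all slopes torsion of bounded order, so q is periodic. Otherwise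
      -- each L-step multiplies the character by a periodic factor that is never 1.
      by_cases htor : ∃ k : ℤ, k ≠ 0 ∧ ∃ n, k • s n = 0
      · left
        obtain ⟨k, hk, n₀, hn₀⟩ := htor
        have hk' : k.natAbs • s n₀ = 0 := by
          rcases Int.natAbs_eq k with h | h <;> rw [h] at hn₀ <;> simpa using hn₀
        refine ⟨L * (K * k.natAbs), Nat.mul_pos hL (Nat.mul_pos hK (Int.natAbs_pos.2 hk)),
          fun n => ?_⟩
        rw [Nat.cast_mul, hqj, mul_comm K, mul_smul, hKs', ← hKs' n₀, smul_comm, hk', smul_zero,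
          add_zero]
      · right
        push Not at htor
        intro k hk a M hM
        refine invMean_eq_zero_of_quasiperiodic
          (ψ := fun n : ℕ => fourier k (M • s (a + M * n))) hL
          (fun n => (norm_fourier_apply _ _).le) (fun n => ?_) (fun n => ?_) (fun n h1 => ?_)
        · rw [← fourier_apply_add, ← hqj]
          congr 2; push_cast; ring
        · have := apply_add_mul_of_periodic hsL M (a + M * n)
          rw [← this]
          congr 3; push_cast; ring_nf
        · rw [fourier_apply_eq_one_iff, ← natCast_zsmul, smul_smul] at h1
          exact htor _ (mul_ne_zero hk (by exact_mod_cast hM.ne')) _ h1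

/-- A sequence in the circle whose nontrivial characters have mean zero visits every nonempty
open set. -/
lemma exists_mem_of_invMean_fourier_eq_zero {p : ℕ → AddCircle (1 : ℝ)}
    (hp : ∀ k : ℤ, k ≠ 0 → invMean (fun n => fourier k (p n)) = 0)
    {U : Set (AddCircle (1 : ℝ))} (hU : IsOpen U) (hne : U.Nonempty) : ∃ n, p n ∈ U := by
  by_contra hno
  push Not at hno
  obtain ⟨x₀, hx₀⟩ := hne
  obtain ⟨g, hg0, hg1, hg01⟩ := exists_continuous_zero_one_of_isClosed (X := AddCircle (1 : ℝ))
    hU.isClosed_compl (isClosed_singleton (x := x₀)) (by simpa using hx₀)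
  set G : C(AddCircle (1 : ℝ), ℂ) := ⟨fun x => (g x : ℂ), by fun_prop⟩ with hG
  set I : C(AddCircle (1 : ℝ), ℂ) → ℂ := fun f => ∫ x, f x ∂AddCircle.haarAddCircle with hI
  have hint : ∀ f : C(AddCircle (1 : ℝ), ℂ),
      MeasureTheory.Integrable f AddCircle.haarAddCircle := fun f =>
    f.continuous.integrable_of_hasCompactSupport (HasCompactSupport.of_compactSpace _)
  have hfb : ∀ (f : C(AddCircle (1 : ℝ), ℂ)) (n : ℕ), ‖f (p n)‖ ≤ ‖f‖ := fun f n =>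
    f.norm_coe_le_norm _
  -- Weyl's criterion: the mean along p agrees with the Haar integral on characters, hence on all
  -- continuous functions by density. A bump function supported in U then gives the contradiction.
  have hclosed : ∀ f : C(AddCircle (1 : ℝ), ℂ), invMean (fun n => f (p n)) = I f := by
    have hspan : ∀ f ∈ Submodule.span ℂ (Set.range (@fourier (1 : ℝ))),
        invMean (fun n => f (p n)) = I f := by
      intro f hf
      induction hf using Submodule.span_induction with
      | mem f hf =>
        obtain ⟨k, rfl⟩ := hf
        rcases eq_or_ne k 0 with rfl | hk
        · simp [hI, invMean_const]
        · rw [hp k hk, hI]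
          have := MeasureTheory.integral_eq_zero_of_add_right_eq_neg (μ := AddCircle.haarAddCircle)
            (fourier_add_half_inv_index (T := (1 : ℝ)) hk one_pos)
          exact this.symm
      | zero => simp [hI, invMean_const]
      | add f₁ f₂ _ _ h1 h2 =>
        simp only [hI, ContinuousMap.add_apply] at *
        rw [invMean_add (hfb f₁) (hfb f₂), h1, h2, MeasureTheory.integral_add (hint _) (hint _)]
      | smul c f _ h =>
        simp only [hI, ContinuousMap.smul_apply, smul_eq_mul] at *
        rw [invMean_smul (hfb f), h, MeasureTheory.integral_const_mul]
    intro f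
    have hmem : f ∈ (Submodule.span ℂ (Set.range (@fourier (1 : ℝ)))).topologicalClosure := by
      rw [span_fourier_closure_eq_top]; trivial
    rw [← SetLike.mem_coe, Submodule.topologicalClosure_coe, Metric.mem_closure_iff] at hmem
    refine eq_of_forall_dist_le fun ε hε => ?_
    obtain ⟨f', hf', hd⟩ := hmem (ε / 2) (by positivity)
    rw [dist_eq_norm] at hd
    have e1 : ‖invMean (fun n => f (p n)) - invMean (fun n => f' (p n))‖ ≤ ε / 2 := by
      have := invMean_add (hfb (f - f')) (hfb f')
      simp only [ContinuousMap.sub_apply, sub_add_cancel] at this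
      rw [this, add_sub_cancel_right]
      exact norm_invMean_le (f := fun n => f (p n) - f' (p n))
        fun n => (hfb (f - f') n).trans hd.le
    have e2 : ‖I f' - I f‖ ≤ ε / 2 := by
      simp only [hI]
      rw [← MeasureTheory.integral_sub (hint _) (hint _)]
      have := MeasureTheory.norm_integral_le_of_norm_le_const (μ := AddCircle.haarAddCircle)
        (f := fun x => f' x - f x) (C := ε / 2) (Eventually.of_forall fun x => by
          rw [norm_sub_rev]
          exact ((f - f').norm_coe_le_norm x).trans hd.le)
      simpa using this
    rw [dist_eq_norm, ← sub_add_sub_cancel _ (invMean fun n => f' (p n)) _]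
    refine (norm_add_le _ _).trans ?_
    have := hspan f' hf'
    rw [this] at e1 ⊢
    linarith
  have h0 := hclosed G
  have hz : (fun n => G (p n)) = fun _ => (0 : ℂ) := by
    ext n
    have := hg0 (show p n ∈ Uᶜ from hno n)
    simp only [Pi.zero_apply] at this
    simp [hG, this]
  rw [hz, invMean_const] at h0
  have h1 : I G = ((∫ x, g x ∂AddCircle.haarAddCircle : ℝ) : ℂ) := integral_ofReal
  rw [h1] at h0
  have h2 : 0 < ∫ x, g x ∂AddCircle.haarAddCircle := by
    refine g.continuous.integral_pos_of_hasCompactSupport_nonneg_nonzero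
      (HasCompactSupport.of_compactSpace _) (fun x => (hg01 x).1) (x := x₀) ?_
    rw [hg1 rfl]; simp
  exact h2.ne (by exact_mod_cast h0)

/-- On [0,1] only the endpoints are identified, so it is enough that one of the two points is
interior. -/
lemma coe_addCircle_injOn {a b : ℝ} (ha : 0 ≤ a) (ha' : a ≤ 1) (hb : 0 < b) (hb' : b < 1)
    (h : (a : AddCircle (1 : ℝ)) = b) : a = b := by
  rw [← sub_eq_zero, ← AddCircle.coe_sub, AddCircle.coe_eq_zero_iff] at h
  obtain ⟨n, hn⟩ := h
  rw [zsmul_eq_mul, mul_one] at hn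
  have h1 : n < 1 := by exact_mod_cast (show (n : ℝ) < 1 by linarith)
  have h2 : -1 < n := by exact_mod_cast (show (-1 : ℝ) < n by linarith)
  have : n = 0 := by omega
  rw [this, Int.cast_zero] at hn
  linarith

lemma exists_mem_Ioo_of_invMean_fourier_eq_zero {u : ℕ → ℝ} (h0 : ∀ n, 0 ≤ u n)
    (h1 : ∀ n, u n ≤ 1)
    (hu : ∀ k : ℤ, k ≠ 0 → invMean (fun n => fourier k (u n : AddCircle (1 : ℝ))) = 0)
    {a b : ℝ} (ha : 0 ≤ a) (hab : a < b) (hb : b ≤ 1) : ∃ n, u n ∈ Set.Ioo a b := by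
  obtain ⟨n, t, ht, htn⟩ := exists_mem_of_invMean_fourier_eq_zero hu
    (QuotientAddGroup.isOpenMap_coe _ (isOpen_Ioo (a := a) (b := b)))
    ((Set.nonempty_Ioo.2 hab).image _)
  refine ⟨n, ?_⟩
  rwa [coe_addCircle_injOn (h0 n) (h1 n) (ha.trans_lt ht.1) (ht.2.trans_le hb) htn.symm]

/-! ### Dilating a tile -/

section Dilation

variable {G : Type*} [AddCommGroup G]

/-- The translation action of `G` on functions, as a monoid homomorphism. -/
def translationHom (G R : Type*) [AddCommGroup G] [CommRing R] :
    Multiplicative G →* Module.End R (G → R) where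
  toFun g := LinearMap.funLeft R R (fun x => x - g.toAdd)
  map_one' := by ext f x; simp [LinearMap.funLeft_apply]
  map_mul' g h := by
    ext f x
    simp [LinearMap.funLeft_apply, sub_sub]

/-- Frobenius in the group algebra over 𝔽_p: if t is the sum of the translations by a i, then t^p is
the sum of those by p • a i. As t f = 1 and t multiplies constants by the cardinality of s, t^p f is
its (p - 1)-th power, which is 1 by Fermat. -/
lemma sum_translate_prime_dilate_mod {ι : Type*} (s : Finset ι) (a : ι → G) (p : ℕ)
    [Fact p.Prime] (hp : ¬ p ∣ s.card) (f : G → ZMod p) (h : ∀ x, ∑ i ∈ s, f (x - a i) = 1)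
    (x : G) : ∑ i ∈ s, f (x - p • a i) = 1 := by
  set Φ := AddMonoidAlgebra.lift (ZMod p) (Module.End (ZMod p) (G → ZMod p)) G
    (translationHom G (ZMod p)) with hΦ
  set t : AddMonoidAlgebra (ZMod p) G := ∑ i ∈ s, AddMonoidAlgebra.single (a i) 1 with ht
  have hΦt : ∀ (b : ι → G) (f : G → ZMod p) (x : G),
      Φ (∑ i ∈ s, AddMonoidAlgebra.single (b i) 1) f x = ∑ i ∈ s, f (x - b i) := by
    intro b f x
    simp [hΦ, map_sum, LinearMap.sum_apply, Finset.sum_apply, translationHom,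
      LinearMap.funLeft_apply]
  have hpow : t ^ p = ∑ i ∈ s, AddMonoidAlgebra.single (p • a i) 1 := by
    have : CharP (AddMonoidAlgebra (ZMod p) G) p :=
      charP_of_injective_algebraMap
        (FaithfulSMul.algebraMap_injective (ZMod p) (AddMonoidAlgebra (ZMod p) G)) p
    rw [ht, sum_pow_char]
    simp [AddMonoidAlgebra.single_pow]
  have h1 : Φ t f = 1 := by ext x; rw [ht, hΦt, h, Pi.one_apply]
  have hc : ∀ n : ℕ, Φ (t ^ n) 1 = fun _ => (s.card : ZMod p) ^ n := by
    intro n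
    induction n with
    | zero => simp; rfl
    | succ n ih =>
      rw [pow_succ', map_mul, Module.End.mul_apply, ih]
      ext x
      rw [ht, hΦt]
      simp [pow_succ']
  have h2 : Φ (t ^ p) f = 1 := by
    rw [← pow_sub_one_mul (Fact.out (p := p.Prime)).ne_zero t, map_mul,
      Module.End.mul_apply, h1, hc]
    ext x
    rw [Pi.one_apply]
    exact ZMod.pow_card_sub_one_eq_one (by rwa [Ne, ZMod.natCast_eq_zero_iff])
  rw [← hΦt, ← hpow, h2, Pi.one_apply]

/-- Being 1 modulo p, the dilated sum is at least 1 everywhere. Summed over the translates by the a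
j it totals the cardinality of s, so no term can exceed 1. -/
lemma sum_translate_prime_dilate {ι : Type*} (s : Finset ι) (a : ι → G) (p : ℕ)
    (hpp : p.Prime) (hp : ¬ p ∣ s.card) (f : G → ℕ) (h : ∀ x, ∑ i ∈ s, f (x - a i) = 1)
    (x : G) : ∑ i ∈ s, f (x - p • a i) = 1 := by
  have := Fact.mk hpp
  have hmod : ∀ y, ((∑ i ∈ s, f (y - p • a i) : ℕ) : ZMod p) = 1 := fun y => by
    push_cast
    refine sum_translate_prime_dilate_mod s a p hp (fun x => (f x : ZMod p)) (fun x => ?_) y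
    exact_mod_cast congrArg (Nat.cast : ℕ → ZMod p) (h x)
  have hge : ∀ y, 1 ≤ ∑ i ∈ s, f (y - p • a i) := fun y => by
    rw [Nat.one_le_iff_ne_zero]
    intro h0
    have := hmod y
    rw [h0, Nat.cast_zero] at this
    exact zero_ne_one this
  have htot : ∀ y, ∑ j ∈ s, ∑ i ∈ s, f (y - a j - p • a i) = ∑ j ∈ s, 1 := fun y => by
    rw [Finset.sum_comm]
    refine Finset.sum_congr rfl fun i _ => ?_
    rw [← h (y - p • a i)]
    exact Finset.sum_congr rfl fun j _ => by rw [sub_right_comm]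
  have hs : s.Nonempty := by
    rw [Finset.nonempty_iff_ne_empty]; rintro rfl; simpa using h 0
  obtain ⟨j, hj⟩ := hs
  have h3 := (Finset.sum_eq_sum_iff_of_le (s := s) (f := fun _ => 1)
    (g := fun j' => ∑ i ∈ s, f (x + a j - a j' - p • a i)) (fun j' _ => hge _)).1
    (htot (x + a j)).symm j hj
  rw [add_sub_cancel_right] at h3
  exact h3.symm

/-- The dilation lemma: a tile may be dilated by any number coprime to its cardinality. -/
lemma sum_translate_dilate {ι : Type*} (s : Finset ι) (a : ι → G) (f : G → ℕ)
    (h : ∀ x, ∑ i ∈ s, f (x - a i) = 1) (r : ℕ) (hr0 : r ≠ 0) (hr : r.Coprime s.card) :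
    ∀ x, ∑ i ∈ s, f (x - r • a i) = 1 := by
  induction r using Nat.recOnMul generalizing a with
  | zero => exact absurd rfl hr0
  | one => simpa using h
  | prime p hp =>
    exact sum_translate_prime_dilate s a p hp ((Nat.Prime.coprime_iff_not_dvd hp).1 hr) f h
  | mul m n hm hn =>
    intro x
    simp only [mul_smul]
    exact hm (fun i => n • a i) (hn a h (right_ne_zero_of_mul hr0) hr.coprime_mul_left)
      (left_ne_zero_of_mul hr0) hr.coprime_mul_right x

end Dilation

/-! ### Iterated averages and the expansion of the indicator -/

section Averages

variable {G : Type*} [AddCommGroup G] {k : ℕ}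

/-- The iterated averages of `f` along the progressions `x - (1 + n q) v_i`, `i < j`. -/
noncomputable def iterAvg (q : ℕ) (f : G → ℝ) (v : Fin k → G) : ℕ → G → ℝ
  | 0, x => f x
  | j + 1, x => if h : j < k then
      invMean (fun n : ℕ => iterAvg q f v j (x - (1 + n * q) • v ⟨j, h⟩)) else iterAvg q f v j x

variable {q : ℕ} {f : G → ℝ}

lemma iterAvg_succ (v : Fin k → G) {j : ℕ} (h : j < k) (x : G) : iterAvg q f v (j + 1) x =
    invMean (fun n : ℕ => iterAvg q f v j (x - (1 + n * q) • v ⟨j, h⟩)) := by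
  rw [iterAvg, dif_pos h]

lemma norm_le_one_of_mem_Icc {a : ℝ} (h : a ∈ Set.Icc (0 : ℝ) 1) : ‖a‖ ≤ 1 := by
  rw [Real.norm_eq_abs, abs_le]
  exact ⟨by linarith [h.1], h.2⟩

lemma iterAvg_mem_Icc (hf : ∀ x, f x ∈ Set.Icc (0 : ℝ) 1) (v : Fin k → G) (j : ℕ) (x : G) :
    iterAvg q f v j x ∈ Set.Icc (0 : ℝ) 1 := by
  induction j generalizing x with
  | zero => rw [iterAvg]; exact hf x
  | succ j ih =>
    by_cases h : j < k
    · rw [iterAvg_succ v h]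
      have hb : ∀ n : ℕ, ‖iterAvg q f v j (x - (1 + n * q) • v ⟨j, h⟩)‖ ≤ 1 := fun n =>
        norm_le_one_of_mem_Icc (ih _)
      exact ⟨invMean_nonneg hb fun n => (ih _).1,
        (le_abs_self _).trans (norm_invMean_le hb)⟩
    · rw [iterAvg, dif_neg h]; exact ih x

lemma norm_iterAvg_le (hf : ∀ x, f x ∈ Set.Icc (0 : ℝ) 1) (v : Fin k → G) (j : ℕ) (x : G) :
    ‖iterAvg q f v j x‖ ≤ 1 := norm_le_one_of_mem_Icc (iterAvg_mem_Icc hf v j x)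

lemma iterAvg_congr {v w : Fin k → G} {j : ℕ} (h : ∀ i : Fin k, (i : ℕ) < j → v i = w i) (x : G) :
    iterAvg q f v j x = iterAvg q f w j x := by
  induction j generalizing x with
  | zero => simp [iterAvg]
  | succ j ih =>
    have ih' := ih fun i hi => h i (hi.trans j.lt_succ_self)
    by_cases hj : j < k
    · rw [iterAvg_succ v hj, iterAvg_succ w hj, h ⟨j, hj⟩ j.lt_succ_self]
      simp only [ih']
    · rw [iterAvg, iterAvg, dif_neg hj, dif_neg hj, ih']

/-- The average along v i acquires the period q • v i from shift invariance of the mean, and later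
averages, commuting with translations, keep it. -/
lemma iterAvg_add_nsmul (hf : ∀ x, f x ∈ Set.Icc (0 : ℝ) 1) (v : Fin k → G) {j : ℕ} {i : Fin k}
    (hi : (i : ℕ) < j) (x : G) : iterAvg q f v j (x + q • v i) = iterAvg q f v j x := by
  induction j generalizing x with
  | zero => exact absurd hi (Nat.not_lt_zero _)
  | succ j ih =>
    by_cases h : j < k
    · rw [iterAvg_succ v h, iterAvg_succ v h]
      rcases Nat.lt_succ_iff_lt_or_eq.1 hi with hlt | heq
      · congr 1; ext n
        rw [add_sub_right_comm, ih hlt]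
      · obtain rfl : i = ⟨j, h⟩ := Fin.ext heq
        rw [← invMean_shift_one (f := fun n : ℕ =>
          iterAvg q f v j (x + q • v ⟨j, h⟩ - (1 + n * q) • v ⟨j, h⟩))
          fun n => norm_iterAvg_le hf v j _]
        congr 1; ext n
        congr 1
        rw [Nat.add_mul, one_mul, ← add_assoc, add_smul _ q]
        abel
    · rw [iterAvg, iterAvg, dif_neg h, dif_neg h, ih (by omega)]

variable {F : Fin k → Finset G}

lemma sum_iterAvg (hf : ∀ x, f x ∈ Set.Icc (0 : ℝ) 1)
    (hF : ∀ i (n : ℕ) x, ∑ u ∈ F i, f (x - (1 + n * q) • u) = 1) (v : Fin k → G) (j : ℕ)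
    (i : Fin k) (n : ℕ) (x : G) : ∑ u ∈ F i, iterAvg q f v j (x - (1 + n * q) • u) = 1 := by
  induction j generalizing x with
  | zero => simpa only [iterAvg] using hF i n x
  | succ j ih =>
    by_cases h : j < k
    · simp only [iterAvg_succ v h]
      rw [← invMean_sum (F i) (f := fun u (n' : ℕ) =>
        iterAvg q f v j (x - (1 + n * q) • u - (1 + n' * q) • v ⟨j, h⟩)) (C := fun _ => 1)
        fun u n' => norm_iterAvg_le hf v j _]
      have hn : ∀ n' : ℕ, ∑ u ∈ F i,
          iterAvg q f v j (x - (1 + n * q) • u - (1 + n' * q) • v ⟨j, h⟩) = 1 := fun n' => by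
        rw [← ih (x - (1 + n' * q) • v ⟨j, h⟩)]
        exact Finset.sum_congr rfl fun u _ => by rw [sub_right_comm]
      simp only [hn, invMean_const]
    · simpa only [iterAvg, dif_neg h] using ih x

variable [DecidableEq G]

/-- Average the tiling identity for the dilates of F i over n. The term of 0 does not depend on n;
that of u becomes one further average, with u as i-th direction. -/
lemma iterAvg_eq_one_sub (hf : ∀ x, f x ∈ Set.Icc (0 : ℝ) 1)
    (hF : ∀ i (n : ℕ) x, ∑ u ∈ F i, f (x - (1 + n * q) • u) = 1) (h0 : ∀ i, 0 ∈ F i)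
    (v : Fin k → G) (i : Fin k) (x : G) : iterAvg q f v i x =
      1 - ∑ u ∈ (F i).erase 0, iterAvg q f (Function.update v i u) (i + 1) x := by
  have h1 : ∀ n : ℕ, (∑ u ∈ (F i).erase 0, iterAvg q f v i (x - (1 + n * q) • u))
      = 1 - iterAvg q f v i x := fun n => by
    rw [eq_sub_iff_add_eq, ← sum_iterAvg hf hF v i i n x, ← Finset.sum_erase_add _ _ (h0 i)]
    simp
  have h2 : ∀ u, iterAvg q f (Function.update v i u) (i + 1) x
      = invMean (fun n : ℕ => iterAvg q f v i (x - (1 + n * q) • u)) := fun u => by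
    rw [iterAvg_succ _ i.2]
    congr 1; ext n
    rw [Function.update_self]
    refine iterAvg_congr (fun i' hi' => ?_) _
    rw [Function.update_of_ne (Fin.ne_of_lt hi')]
  simp only [h2]
  rw [← invMean_sum _ (f := fun u (n : ℕ) => iterAvg q f v i (x - (1 + n * q) • u))
    (C := fun _ => 1) fun u n => norm_iterAvg_le hf v i _]
  simp only [h1, invMean_const]
  ring

/-- Tuples that choose nonzero elements of the first `j` tiles and agree with `v₀` from then on. -/
def prefixTuples (F : Fin k → Finset G) (v₀ : Fin k → G) (j : ℕ) : Finset (Fin k → G) :=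
  Fintype.piFinset fun i => if (i : ℕ) < j then (F i).erase 0 else {v₀ i}

lemma sum_prefixTuples_succ (v₀ : Fin k → G) (i : Fin k) (φ : (Fin k → G) → ℝ) :
    ∑ w ∈ prefixTuples F v₀ (i + 1), φ w =
      ∑ w ∈ prefixTuples F v₀ i, ∑ u ∈ (F i).erase 0, φ (Function.update w i u) := by
  rw [← Finset.sum_product']
  refine Finset.sum_nbij' (fun w => (Function.update w i (v₀ i), w i))
    (fun p => Function.update p.1 i p.2) ?_ ?_ ?_ ?_ ?_
  · intro w hw
    rw [prefixTuples, Fintype.mem_piFinset] at hw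
    rw [Finset.mem_product, prefixTuples, Fintype.mem_piFinset]
    refine ⟨fun i' => ?_, by simpa using hw i⟩
    rcases eq_or_ne i' i with rfl | hne
    · simp
    · have hiff : (i' : ℕ) < i + 1 ↔ (i' : ℕ) < i := by
        have := Fin.val_ne_of_ne hne; omega
      simpa [Function.update_of_ne hne, hiff] using hw i'
  · rintro ⟨w, u⟩ hw
    rw [Finset.mem_product, prefixTuples, Fintype.mem_piFinset] at hw
    rw [prefixTuples, Fintype.mem_piFinset]
    intro i'
    rcases eq_or_ne i' i with rfl | hne
    · simpa using hw.2
    · have hiff : (i' : ℕ) < i + 1 ↔ (i' : ℕ) < i := by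
        have := Fin.val_ne_of_ne hne; omega
      simpa [Function.update_of_ne hne, hiff] using hw.1 i'
  · intro w _; simp
  · rintro ⟨w, u⟩ hw
    rw [Finset.mem_product, prefixTuples, Fintype.mem_piFinset] at hw
    have : w i = v₀ i := by simpa using hw.1 i
    simp [← this]
  · intro w _; simp

/-- Iterates `iterAvg_eq_one_sub`. The tuple v₀ only fills the entries not yet averaged over. -/
lemma exists_eq_add_sum_prefixTuples (hf : ∀ x, f x ∈ Set.Icc (0 : ℝ) 1)
    (hF : ∀ i (n : ℕ) x, ∑ u ∈ F i, f (x - (1 + n * q) • u) = 1) (h0 : ∀ i, 0 ∈ F i)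
    (v₀ : Fin k → G) {j : ℕ} (hj : j ≤ k) :
    ∃ c : ℝ, ∀ x, f x = c + (-1) ^ j * ∑ w ∈ prefixTuples F v₀ j, iterAvg q f w j x := by
  induction j with
  | zero =>
    refine ⟨0, fun x => ?_⟩
    have : prefixTuples F v₀ 0 = {v₀} := by
      ext w; simp [prefixTuples, funext_iff]
    simp [this, iterAvg]
  | succ j ih =>
    obtain ⟨c, hc⟩ := ih (by omega)
    refine ⟨c + (-1) ^ j * (prefixTuples F v₀ j).card, fun x => ?_⟩
    have hi := sum_prefixTuples_succ (F := F) v₀ ⟨j, hj⟩ (fun w => iterAvg q f w (j + 1) x)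
    simp only at hi
    have hrec := fun w => iterAvg_eq_one_sub hf hF h0 w ⟨j, hj⟩ x
    simp only at hrec
    rw [hc x, hi, Finset.sum_congr rfl fun w _ => hrec w, Finset.sum_sub_distrib]
    simp
    ring

/-- The tuples of nonzero elements of the tiles. -/
def nonzeroTuples (F : Fin k → Finset G) : Finset (Fin k → G) :=
  Fintype.piFinset fun i => (F i).erase 0

lemma exists_sum_iterAvg_eq_add_int (hf : ∀ x, f x = 0 ∨ f x = 1)
    (hF : ∀ i (n : ℕ) x, ∑ u ∈ F i, f (x - (1 + n * q) • u) = 1) (h0 : ∀ i, 0 ∈ F i)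
    (v₀ : Fin k → G) :
    ∃ c : ℝ, ∀ x, ∃ n : ℤ, ∑ w ∈ nonzeroTuples F, iterAvg q f w k x = c + n := by
  have hf' : ∀ x, f x ∈ Set.Icc (0 : ℝ) 1 := fun x => by
    rcases hf x with h | h <;> simp [h]
  obtain ⟨c, hc⟩ := exists_eq_add_sum_prefixTuples hf' hF h0 v₀ le_rfl
  have hT : prefixTuples F v₀ k = nonzeroTuples F := by
    ext w; simp [prefixTuples, nonzeroTuples]
  rw [hT] at hc
  have hs : ((-1 : ℝ) ^ k) * (-1) ^ k = 1 := by rw [← mul_pow]; simp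
  refine ⟨-(-1) ^ k * c, fun x => ?_⟩
  have h1 : ∑ w ∈ nonzeroTuples F, iterAvg q f w k x = (-1) ^ k * (f x - c) := by
    rw [hc x, add_sub_cancel_left, ← mul_assoc, hs, one_mul]
  rcases hf x with h | h
  · exact ⟨0, by rw [h1, h]; push_cast; ring⟩
  · exact ⟨(-1) ^ k, by rw [h1, h]; push_cast; ring⟩

end Averages

/-! ### Saturated lattices spanned by tuples -/

section Saturation

variable {k d : ℕ}

/-- The saturation of the subgroup generated by a tuple of vectors. -/
def saturation (v : Fin k → Fin d → ℤ) : AddSubgroup (Fin d → ℤ) where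
  carrier := {x | ∃ n : ℕ, 0 < n ∧ n • x ∈ AddSubgroup.closure (Set.range v)}
  zero_mem' := ⟨1, one_pos, by simp⟩
  add_mem' := by
    rintro a b ⟨n, hn, ha⟩ ⟨m, hm, hb⟩
    refine ⟨n * m, Nat.mul_pos hn hm, ?_⟩
    rw [smul_add]
    refine add_mem ?_ ?_
    · rw [mul_comm, mul_smul]; exact AddSubgroup.nsmul_mem _ ha m
    · rw [mul_smul]; exact AddSubgroup.nsmul_mem _ hb n
  neg_mem' := by
    rintro a ⟨n, hn, ha⟩
    exact ⟨n, hn, by rw [smul_neg]; exact neg_mem ha⟩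

lemma closure_le_saturation (v : Fin k → Fin d → ℤ) :
    AddSubgroup.closure (Set.range v) ≤ saturation v := fun x hx => ⟨1, one_pos, by simpa using hx⟩

lemma apply_mem_saturation (v : Fin k → Fin d → ℤ) (i : Fin k) : v i ∈ saturation v :=
  closure_le_saturation v (AddSubgroup.subset_closure ⟨i, rfl⟩)

lemma mem_saturation_of_nsmul {v : Fin k → Fin d → ℤ} {x : Fin d → ℤ} {n : ℕ} (hn : 0 < n)
    (h : n • x ∈ saturation v) : x ∈ saturation v := by
  obtain ⟨m, hm, h⟩ := h
  exact ⟨m * n, Nat.mul_pos hm hn, by rwa [mul_smul]⟩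

lemma mem_saturation_of_zsmul {v : Fin k → Fin d → ℤ} {x : Fin d → ℤ} {n : ℤ} (hn : n ≠ 0)
    (h : n • x ∈ saturation v) : x ∈ saturation v := by
  refine mem_saturation_of_nsmul (Int.natAbs_pos.2 hn) ?_
  rcases Int.natAbs_eq n with e | e
  · rwa [e, natCast_zsmul] at h
  · rw [e, neg_smul, natCast_zsmul] at h
    exact neg_mem_iff.1 h

lemma saturation_le_of_forall_mem {v w : Fin k → Fin d → ℤ} (h : ∀ i, v i ∈ saturation w) :
    saturation v ≤ saturation w := by
  rintro x ⟨n, hn, hx⟩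
  refine mem_saturation_of_nsmul hn ?_
  have : AddSubgroup.closure (Set.range v) ≤ saturation w := by
    rw [AddSubgroup.closure_le]; rintro _ ⟨i, rfl⟩; exact h i
  exact this hx

lemma cast_mem_realSpan {w : Fin k → Fin d → ℤ} {x : Fin d → ℤ} (hx : x ∈ saturation w) :
    (fun j => (x j : ℝ)) ∈ realSpan w := by
  obtain ⟨n, hn, hx⟩ := hx
  have key : ∀ y ∈ AddSubgroup.closure (Set.range w), (fun j => (y j : ℝ)) ∈ realSpan w := by
    intro y hy
    induction hy using AddSubgroup.closure_induction with
    | mem y hy =>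
      obtain ⟨i, rfl⟩ := hy
      exact Submodule.subset_span ⟨i, rfl⟩
    | zero =>
      convert (realSpan w).zero_mem using 1
      ext j; simp
    | add y z _ _ h1 h2 => simpa using! (realSpan w).add_mem h1 h2
    | neg y _ h =>
      convert (realSpan w).neg_mem h using 1
      ext j; simp
  have h1 := (realSpan w).smul_mem ((n : ℝ)⁻¹) (key _ hx)
  have hn' : (n : ℝ) ≠ 0 := by exact_mod_cast hn.ne'
  convert h1 using 1
  ext j
  simp [hn']

lemma realSpan_eq_of_saturation_eq {v w : Fin k → Fin d → ℤ} (h : saturation v = saturation w) :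
    realSpan v = realSpan w := by
  apply le_antisymm <;> rw [realSpan, Submodule.span_le] <;> rintro _ ⟨i, rfl⟩
  · exact cast_mem_realSpan (h ▸ apply_mem_saturation v i)
  · exact cast_mem_realSpan (h ▸ apply_mem_saturation w i)

end Saturation

/-! ### Hyperplane lattices and transversality -/

section Hyperplane

variable {k : ℕ} {v w : Fin k → Fin (k + 1) → ℤ}

/-- Cramer's rule: e and the v i are the rows of a matrix with nonzero determinant, and the adjugate
expresses the determinant times g through these rows. -/
lemma exists_nsmul_eq_add_of_notMem (hv : LinearIndependent ℤ v) {e : Fin (k + 1) → ℤ}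
    (he : e ∉ saturation v) : ∃ N : ℕ, 0 < N ∧ ∀ g : Fin (k + 1) → ℤ,
      ∃ s ∈ AddSubgroup.closure (Set.range v), ∃ c : ℤ, N • g = s + c • e := by
  set M : Matrix (Fin (k + 1)) (Fin (k + 1)) ℤ := Fin.cons e v with hM
  have hvec : ∀ c : Fin (k + 1) → ℤ,
      Matrix.vecMul c M = (∑ i : Fin k, c i.succ • v i) + c 0 • e := by
    intro c
    rw [Matrix.vecMul_eq_sum, Fin.sum_univ_succ]
    exact add_comm _ _
  have hmem : ∀ c : Fin k → ℤ, ∑ i, c i • v i ∈ AddSubgroup.closure (Set.range v) := fun c =>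
    sum_mem fun i _ => AddSubgroup.zsmul_mem _ (AddSubgroup.subset_closure (Set.mem_range_self i)) _
  have hdet : M.det ≠ 0 := by
    rw [Ne, ← Matrix.exists_vecMul_eq_zero_iff]
    rintro ⟨c, hc, h⟩
    rw [hvec] at h
    have hc0 : c 0 = 0 := by
      by_contra hne
      refine he (mem_saturation_of_zsmul hne ?_)
      rw [← neg_eq_of_add_eq_zero_right h]
      exact neg_mem (closure_le_saturation v (hmem _))
    rw [hc0, zero_smul, add_zero] at h
    have := Fintype.linearIndependent_iff.1 hv _ h
    exact hc (funext fun i => Fin.cases hc0 this i)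
  refine ⟨M.det.natAbs, Int.natAbs_pos.2 hdet, fun g => ?_⟩
  obtain ⟨c, hc⟩ : ∃ c : Fin (k + 1) → ℤ, Matrix.vecMul c M = M.det.natAbs • g := by
    have h1 : Matrix.vecMul (Matrix.vecMul g M.adjugate) M = M.det • g := by
      rw [Matrix.vecMul_vecMul, Matrix.adjugate_mul, Matrix.vecMul_smul, Matrix.vecMul_one]
    rcases Int.natAbs_eq M.det with h | h
    · refine ⟨_, h1.trans ?_⟩
      conv_lhs => rw [h]
      exact natCast_zsmul _ _
    · refine ⟨-(Matrix.vecMul g M.adjugate), ?_⟩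
      rw [Matrix.neg_vecMul, h1]
      conv_lhs => rw [h]
      rw [neg_smul, neg_neg, natCast_zsmul]
  exact ⟨_, hmem fun i => c i.succ, c 0, by rw [← hc, hvec]⟩

/-- A nonzero integer vector orthogonal to all v i exists, and it cannot be orthogonal to itself. -/
lemma exists_notMem_saturation (v : Fin k → Fin (k + 1) → ℤ) : ∃ e, e ∉ saturation v := by
  set M : Matrix (Fin (k + 1)) (Fin (k + 1)) ℤ := Fin.cons 0 v with hM
  have hdet : M.det = 0 := Matrix.det_eq_zero_of_row_eq_zero 0 fun j => rfl
  obtain ⟨u, hu, h⟩ := Matrix.exists_mulVec_eq_zero_iff.2 hdet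
  have hdot : ∀ y ∈ AddSubgroup.closure (Set.range v), y ⬝ᵥ u = 0 := by
    intro y hy
    induction hy using AddSubgroup.closure_induction with
    | mem y hy =>
      obtain ⟨i, rfl⟩ := hy
      exact congrFun h i.succ
    | zero => exact zero_dotProduct u
    | add y z _ _ h1 h2 => rw [add_dotProduct, h1, h2, add_zero]
    | neg y _ h => rw [neg_dotProduct, h, neg_zero]
  refine ⟨u, ?_⟩
  rintro ⟨n, hn, hmem⟩
  have := hdot _ hmem
  rw [smul_dotProduct, smul_eq_zero] at this
  exact hu (dotProduct_self_eq_zero.1 (this.resolve_left hn.ne'))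

lemma exists_nsmul_eq_add_of_saturation_ne (hv : LinearIndependent ℤ v)
    (hw : LinearIndependent ℤ w) (hne : saturation v ≠ saturation w) :
    ∃ K : ℕ, 0 < K ∧ ∀ g, ∃ a ∈ saturation v, ∃ b ∈ saturation w, K • g = a + b := by
  by_cases h : ∀ i, w i ∈ saturation v
  · have h' : ¬ ∀ i, v i ∈ saturation w := fun h' =>
      hne (le_antisymm (saturation_le_of_forall_mem h') (saturation_le_of_forall_mem h))
    push Not at h'
    obtain ⟨i, hi⟩ := h'
    obtain ⟨K, hK, h⟩ := exists_nsmul_eq_add_of_notMem hw hi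
    refine ⟨K, hK, fun g => ?_⟩
    obtain ⟨s, hs, c, hc⟩ := h g
    exact ⟨c • v i, AddSubgroup.zsmul_mem _ (apply_mem_saturation v i) c, s,
      closure_le_saturation w hs, hc.trans (add_comm _ _)⟩
  · push Not at h
    obtain ⟨i, hi⟩ := h
    obtain ⟨K, hK, h⟩ := exists_nsmul_eq_add_of_notMem hv hi
    refine ⟨K, hK, fun g => ?_⟩
    obtain ⟨s, hs, c, hc⟩ := h g
    exact ⟨s, closure_le_saturation v hs, c • w i,
      AddSubgroup.zsmul_mem _ (apply_mem_saturation w i) c, hc⟩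

lemma exists_nsmul_saturation_mem_closure (hv : LinearIndependent ℤ v) :
    ∃ N : ℕ, 0 < N ∧ ∀ h ∈ saturation v, N • h ∈ AddSubgroup.closure (Set.range v) := by
  obtain ⟨e, he⟩ := exists_notMem_saturation v
  obtain ⟨N, hN, h⟩ := exists_nsmul_eq_add_of_notMem hv he
  refine ⟨N, hN, fun x hx => ?_⟩
  obtain ⟨s, hs, c, hc⟩ := h x
  have hc0 : c = 0 := by
    by_contra hne
    refine he (mem_saturation_of_zsmul hne ?_)
    rw [← sub_eq_iff_eq_add'.2 hc]
    exact sub_mem (AddSubgroup.nsmul_mem _ hx N) (closure_le_saturation v hs)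
  rwa [hc, hc0, zero_smul, add_zero]

lemma exists_forall_add_nsmul_saturation_eq {Y : Type*} (hv : LinearIndependent ℤ v) {q : ℕ}
    (hq : 0 < q) {u : (Fin (k + 1) → ℤ) → Y} (hu : ∀ i x, u (x + q • v i) = u x) :
    ∃ N : ℕ, 0 < N ∧ ∀ h ∈ saturation v, ∀ x, u (x + N • h) = u x := by
  obtain ⟨N, hN, hmem⟩ := exists_nsmul_saturation_mem_closure hv
  have key : ∀ s ∈ AddSubgroup.closure (Set.range v), ∀ x, u (x + q • s) = u x := by
    intro s hs
    induction hs using AddSubgroup.closure_induction with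
    | mem s hs => obtain ⟨i, rfl⟩ := hs; exact hu i
    | zero => simp
    | add y z _ _ h1 h2 => intro x; rw [smul_add, ← add_assoc, h2, h1]
    | neg y _ h => intro x; rw [← h (x + q • -y)]; simp
  exact ⟨q * N, Nat.mul_pos hq hN, fun h hh x => by rw [mul_smul]; exact key _ (hmem h hh) x⟩

lemma le_finrank_map_saturation (hv : LinearIndependent ℤ v) {N : ℕ} (hN : 0 < N) :
    k ≤ Module.finrank ℤ ((saturation v).map (nsmulAddMonoidHom N)) := by
  set L := (saturation v).map (nsmulAddMonoidHom (α := Fin (k + 1) → ℤ) N) with hL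
  have hfin : Module.Finite ℤ (AddSubgroup.toIntSubmodule L) := inferInstance
  have hmem : ∀ i, N • v i ∈ AddSubgroup.toIntSubmodule L := fun i =>
    ⟨v i, apply_mem_saturation v i, rfl⟩
  have hli : LinearIndependent ℤ (fun i => (⟨N • v i, hmem i⟩ : AddSubgroup.toIntSubmodule L)) := by
    refine LinearIndependent.of_comp (AddSubgroup.toIntSubmodule L).subtype ?_
    rw [Fintype.linearIndependent_iff] at hv ⊢
    intro c hc i
    have h1 : ∑ i, ((N : ℤ) * c i) • v i = 0 := by
      rw [← hc]
      refine Finset.sum_congr rfl fun i _ => ?_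
      simp only [Function.comp_apply, Submodule.subtype_apply, mul_comm (N : ℤ), mul_smul,
        natCast_zsmul]
    have := hv _ h1 i
    exact (mul_eq_zero.1 this).resolve_left (by exact_mod_cast hN.ne')
  have := hli.fintype_card_le_finrank
  rw [Fintype.card_fin] at this
  exact this

end Hyperplane

/-! ### The dichotomy between constancy and full oscillation -/

section Oscillation

variable {G : Type*} [AddCommGroup G]

/-- `u` is constant on the coset `x + M G`. -/
def ConstOnCoset (u : G → ℝ) (M : ℕ) (x : G) : Prop := ∀ g, u (x + M • g) = u x

/-- A `[0,1]`-valued function has infimum `0` and supremum `1` on the coset `x + M G`. -/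
def FullOscOnCoset (u : G → ℝ) (M : ℕ) (x : G) : Prop :=
  ∀ ε : ℝ, 0 < ε → (∃ g, u (x + M • g) < ε) ∧ ∃ g, 1 - ε < u (x + M • g)

/-- On each coset of `M G`, for `M` a multiple of `N`, the function `u` is constant, or it has full
oscillation and is `M H`-periodic for some `H` in `S`. -/
def ConstOrOsc (N : ℕ) (S : Set (AddSubgroup G)) (u : G → ℝ) : Prop :=
  ∀ M : ℕ, 0 < M → N ∣ M → ∀ x, ConstOnCoset u M x ∨
    FullOscOnCoset u M x ∧ ∃ H ∈ S, ∀ g, ∀ h ∈ H, u (x + M • g + M • h) = u (x + M • g)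

lemma ConstOrOsc.mono {N N' : ℕ} {S S' : Set (AddSubgroup G)} {u : G → ℝ}
    (h : ConstOrOsc N S u) (hN : N ∣ N') (hS : S ⊆ S') : ConstOrOsc N' S' u := by
  intro M hM hNM x
  rcases h M hM (hN.trans hNM) x with h | ⟨h, H, hH, hper⟩
  · exact Or.inl h
  · exact Or.inr ⟨h, H, hS hH, hper⟩

lemma ConstOnCoset.of_dvd {u : G → ℝ} {M M' : ℕ} {x : G} (h : ConstOnCoset u M' x) (hd : M' ∣ M) :
    ConstOnCoset u M x := by
  obtain ⟨t, rfl⟩ := hd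
  intro g
  rw [mul_smul]; exact h _

/-- Two nonconstant terms on one coset would both have supremum 1, and their transversal periods
would produce a point where both exceed 1/2. With a single nonconstant term, its supremum 1 forces
the other, constant, terms to add up to 0. -/
lemma constOrOsc_one_sub_sum {ι : Type*} {s : Finset ι} {u : ι → G → ℝ} {N K : ℕ} (hN : 0 < N)
    {S : ι → Set (AddSubgroup G)} (h0 : ∀ i ∈ s, ∀ x, 0 ≤ u i x)
    (h1 : ∀ x, ∑ i ∈ s, u i x ≤ 1) (hu : ∀ i ∈ s, ConstOrOsc N (S i) (u i))
    (hS : ∀ i ∈ s, ∀ j ∈ s, i ≠ j → ∀ H ∈ S i, ∀ H' ∈ S j,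
      ∀ g, ∃ a ∈ H, ∃ b ∈ H', K • g = a + b) :
    ConstOrOsc (K * N) (⋃ i ∈ s, S i) (fun x => 1 - ∑ i ∈ s, u i x) := by
  classical
  rintro _ hM ⟨t, rfl⟩ x
  have ht : 0 < t := Nat.pos_of_mul_pos_left hM
  set M₀ := N * t with hM₀
  have hM₀pos : 0 < M₀ := Nat.mul_pos hN ht
  set M := K * N * t with hMdef
  have hMM₀ : M = M₀ * K := by rw [hM₀, hMdef]; ring
  have hNM : N ∣ M := ⟨K * t, by rw [hMdef]; ring⟩
  by_cases hall : ∀ i ∈ s, ConstOnCoset (u i) M x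
  · left
    intro g
    simp only
    rw [Finset.sum_congr rfl fun i hi => hall i hi g]
  push Not at hall
  obtain ⟨i, hi, hnc⟩ := hall
  obtain ⟨hosc, H, hH, hper⟩ := (hu i hi M hM hNM x).resolve_left hnc
  have hother : ∀ j ∈ s, j ≠ i → ConstOnCoset (u j) M x := by
    intro j hj hji
    by_contra hncj
    have hoscj := ((hu j hj M hM hNM x).resolve_left hncj).1
    -- Large values are taken on the coset of M, but periods on the larger coset of M₀ = M / K: the
    -- factor K pays for splitting gj - gi along the two subgroups.
    obtain ⟨-, Hi, hHi, hperi⟩ := (hu i hi M₀ hM₀pos (Dvd.intro t rfl) x).resolve_left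
      fun hc => hnc (hc.of_dvd ⟨K, hMM₀⟩)
    obtain ⟨-, Hj, hHj, hperj⟩ := (hu j hj M₀ hM₀pos (Dvd.intro t rfl) x).resolve_left
      fun hc => hncj (hc.of_dvd ⟨K, hMM₀⟩)
    obtain ⟨gi, hgi⟩ := (hosc (1 / 2) one_half_pos).2
    obtain ⟨gj, hgj⟩ := (hoscj (1 / 2) one_half_pos).2
    obtain ⟨a, ha, b, hb, hab⟩ := hS i hi j hj hji.symm Hi hHi Hj hHj (gj - gi)
    have e1 := hperi (K • gi) a ha
    have e2 := hperj (K • gj) (-b) (neg_mem hb)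
    have e3 : x + M₀ • K • gj + M₀ • -b = x + M₀ • K • gi + M₀ • a := by
      have : K • gj = K • gi + (a + b) := by rw [← hab, smul_sub]; abel
      rw [this]; simp only [smul_add, smul_neg]; abel
    rw [e3] at e2
    rw [← mul_smul, ← hMM₀] at e1 e2
    have hle : ∑ l ∈ {i, j}, u l (x + M • gi + M₀ • a) ≤
        ∑ l ∈ s, u l (x + M • gi + M₀ • a) :=
      Finset.sum_le_sum_of_subset_of_nonneg
        (by intro l hl; rcases Finset.mem_insert.1 hl with rfl | hl
            · exact hi
            · rw [Finset.mem_singleton.1 hl]; exact hj) fun l hl _ => h0 l hl _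
    rw [Finset.sum_pair hji.symm, e1] at hle
    have e2' : u j (x + M • gi + M₀ • a) = u j (x + M • gj) := by
      rw [e2, ← mul_smul, ← hMM₀]
    rw [e2'] at hle
    have := h1 (x + M • gi + M₀ • a)
    linarith
  have hsum : ∀ g, ∑ j ∈ s, u j (x + M • g) = u i (x + M • g) + ∑ j ∈ s.erase i, u j x := by
    intro g
    rw [← Finset.add_sum_erase _ _ hi]
    congr 1
    exact Finset.sum_congr rfl fun j hj =>
      hother j (Finset.mem_of_mem_erase hj) (Finset.ne_of_mem_erase hj) g
  have hrest : ∑ j ∈ s.erase i, u j x = 0 := by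
    refine le_antisymm (le_of_forall_pos_le_add fun ε hε => ?_)
      (Finset.sum_nonneg fun j hj => h0 j (Finset.mem_of_mem_erase hj) x)
    obtain ⟨g, hg⟩ := (hosc ε hε).2
    have := h1 (x + M • g)
    rw [hsum] at this
    linarith
  simp only [hrest, add_zero] at hsum
  right
  refine ⟨fun ε hε => ?_, H, Set.mem_biUnion hi hH, fun g h hh => ?_⟩
  · obtain ⟨⟨a, ha⟩, b, hb⟩ := hosc ε hε
    refine ⟨⟨b, ?_⟩, a, ?_⟩ <;> simp only [hsum] <;> linarith
  · have := hper g h hh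
    simp only
    rw [add_assoc, ← smul_add] at this ⊢
    rw [hsum, hsum, this]

/-- If a periodic function is, up to a constant, a sum of functions periodic in transversal
directions, then it is polynomial along lines. -/
lemma isPolySeq_of_add_sum_const {X ι : Type*} [AddCommGroup X] {N K : ℕ} {H : AddSubgroup G}
    (I : Finset ι) (H' : ι → AddSubgroup G)
    (htrans : ∀ i ∈ I, ∀ g, ∃ a ∈ H, ∃ b ∈ H' i, K • g = a + b)
    {p : G → X} (hp : ∀ h ∈ H, ∀ x, p (x + N • h) = p x) {p' : ι → G → X}
    (hp' : ∀ i ∈ I, ∀ h ∈ H' i, ∀ x, p' i (x + N • h) = p' i x) {c : X}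
    (hc : ∀ x, p x + ∑ i ∈ I, p' i x = c) (x e : G) :
    IsPolySeq I.card (fun n : ℤ => p (x + n • (N * K) • e)) := by
  classical
  induction I using Finset.induction_on generalizing p p' c with
  | empty =>
    intro n
    simp only [Finset.sum_empty, add_zero] at hc
    simp only [hc]
  | insert i I hi ih =>
    rw [Finset.card_insert_of_notMem hi]
    intro m
    -- The shift by m steps along the line splits into N • a, which p does not see, and N • b, which
    -- p' i does not see. Differencing by N • b thus removes the term i.
    obtain ⟨a, ha, b, hb, hab⟩ := htrans i (Finset.mem_insert_self i I) (m • e)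
    have hshift : ∀ n : ℤ, p (x + (n + m) • (N * K) • e) - p (x + n • (N * K) • e)
        = (fun y => p (y + N • b) - p y) (x + n • (N * K) • e) := fun n => by
      simp only
      congr 1
      rw [← hp a ha (x + n • (N * K) • e + N • b)]
      congr 1
      have : m • (N * K) • e = N • a + N • b := by
        rw [← smul_add, ← hab, mul_smul, smul_comm m, smul_comm m]
      rw [add_smul, this]; abel
    simp only [hshift]
    refine ih (p := fun y => p (y + N • b) - p y)
      (p' := fun j y => p' j (y + N • b) - p' j y) (c := 0)
      (fun j hj => htrans j (Finset.mem_insert_of_mem hj)) (fun h hh y => ?_)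
      (fun j hj h hh y => ?_) fun y => ?_
    · rw [add_right_comm, hp h hh, hp h hh]
    · rw [add_right_comm, hp' j (Finset.mem_insert_of_mem hj) h hh,
        hp' j (Finset.mem_insert_of_mem hj) h hh]
    · have e1 := hc (y + N • b)
      have e2 := hc y
      rw [Finset.sum_insert hi] at e1 e2
      rw [hp' i (Finset.mem_insert_self i I) b hb] at e1
      rw [Finset.sum_sub_distrib, ← sub_eq_zero.2 (e1.trans e2.symm)]
      abel

/-- Modulo the periods of Φ, a coset is read off from a line in direction e, where the Weyl
dichotomy applies. If Φ is constant modulo 1, two different values in [0,1] must be 0 and 1; if it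
equidistributes, it comes arbitrarily close to both. -/
lemma constOrOsc_of_isPolySeq (hfin : ∀ Q : ℕ, 0 < Q → ∃ R : Finset G, ∀ x, ∃ r ∈ R, ∃ g,
      x = r + Q • g) {H : AddSubgroup G} {Φ : G → ℝ} (hΦ : ∀ x, Φ x ∈ Set.Icc (0 : ℝ) 1)
    {N₀ : ℕ} (hN₀ : 0 < N₀) (hper : ∀ h ∈ H, ∀ x, Φ (x + N₀ • h) = Φ x)
    {e : G} {N : ℕ} (hN : 0 < N) (he : ∀ g, ∃ h ∈ H, ∃ j : ℤ, N • g = h + j • e)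
    {L m : ℕ} (hL : 0 < L)
    (hpoly : ∀ x, IsPolySeq m (fun n : ℤ => (Φ (x + n • L • e) : AddCircle (1 : ℝ)))) :
    ∃ N' : ℕ, 0 < N' ∧ ConstOrOsc N' {H} Φ := by
  have hper' : ∀ (t : ℕ), ∀ h ∈ H, ∀ x, Φ (x + (N₀ * t) • h) = Φ x := fun t h hh x => by
    rw [mul_smul]; exact hper _ (AddSubgroup.nsmul_mem _ hh t) x
  set Q := N₀ * L * N with hQ
  have hQpos : 0 < Q := Nat.mul_pos (Nat.mul_pos hN₀ hL) hN
  obtain ⟨R, hR⟩ := hfin Q hQpos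
  set qs : G → ℤ → AddCircle (1 : ℝ) := fun x n => (Φ (x + n • L • e) : AddCircle (1 : ℝ)) with hqs
  have hline : ∀ (x g : G) (t : ℕ), ∃ j : ℤ, ∀ n : ℤ,
      Φ (x + (Q * t) • g + n • L • e) = Φ (x + (n + N₀ * t * j) • L • e) := by
    intro x g t
    obtain ⟨h, hh, j, hj⟩ := he g
    refine ⟨j, fun n => ?_⟩
    rw [← hper' (L * t) h hh (x + (n + N₀ * t * j) • L • e)]
    congr 1
    have : (Q * t) • g = (N₀ * (L * t)) • h + (N₀ * t * j) • L • e := by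
      have h1 : (Q * t) • g = (N₀ * L * t) • N • g := by rw [← mul_smul, hQ]; congr 1; ring
      rw [h1, hj, smul_add, mul_assoc N₀ L t]
      congr 1
      simp only [← natCast_zsmul, ← mul_smul]
      congr 1; push_cast; ring
    rw [this, add_smul]; abel
  have hex : ∀ r : G, ∃ t : ℕ, 0 < t ∧ ((∀ n, qs r (n + t) = qs r n) ∨
      ∀ k : ℤ, k ≠ 0 → ∀ (a : ℤ) (M : ℕ), 0 < M →
        invMean (fun n : ℕ => fourier k (qs r (a + M * n))) = 0) := fun r => by
    rcases (hpoly r).periodic_or_invMean_eq_zero with ⟨t, ht, h⟩ | h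
    · exact ⟨t, ht, Or.inl h⟩
    · exact ⟨1, one_pos, Or.inr h⟩
  choose per hperpos hdich using hex
  -- Finitely many lines, one for each residue modulo Q, represent all cosets, so a product of their
  -- periods serves them all.
  refine ⟨Q * ∏ r ∈ R, per r, Nat.mul_pos hQpos (Finset.prod_pos fun r _ => hperpos r), ?_⟩
  rintro _ hM ⟨t', rfl⟩ x
  obtain ⟨r, hr, g, rfl⟩ := hR x
  obtain ⟨j₀, hj₀⟩ := hline r g 1
  rw [mul_one] at hj₀
  obtain ⟨T, hT⟩ : per r ∣ ∏ r ∈ R, per r := Finset.dvd_prod_of_mem per hr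
  set t := (∏ r ∈ R, per r) * t' with ht
  have hMt : Q * (∏ r ∈ R, per r) * t' = Q * t := by rw [ht, mul_assoc]
  rw [hMt] at hM ⊢
  have htpos : 0 < t := Nat.pos_of_mul_pos_left hM
  have hperM : ∀ g', ∀ h ∈ H, Φ (r + Q • g + (Q * t) • g' + (Q * t) • h)
      = Φ (r + Q • g + (Q * t) • g') := fun g' h hh => by
    have h1 := hper' (L * N * t) h hh (r + Q • g + (Q * t) • g')
    rwa [show N₀ * (L * N * t) = Q * t by rw [hQ]; ring] at h1
  rcases hdich r with hp | hmean
  · have hmod : ∀ g', (Φ (r + Q • g + (Q * t) • g') : AddCircle (1 : ℝ)) = Φ (r + Q • g) := by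
      intro g'
      obtain ⟨j, hj⟩ := hline (r + Q • g) g' t
      have h1 := hj 0
      have h2 := hj₀ (0 + N₀ * t * j)
      have h3 := hj₀ 0
      rw [zero_smul, add_zero] at h1 h3
      rw [h1, h2, h3]
      have hpz : Function.Periodic (qs r) (per r : ℤ) := hp
      have h4 := hpz.int_mul (T * t' * (N₀ * j)) (0 + N₀ * (1 : ℕ) * j₀)
      refine (congrArg (qs r) (?_ : (0 + N₀ * t * j + N₀ * (1 : ℕ) * j₀ : ℤ) = _)).trans h4
      rw [ht, hT]; push_cast; ring
    by_cases hc : ConstOnCoset Φ (Q * t) (r + Q • g)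
    · exact Or.inl hc
    · right
      refine ⟨?_, H, rfl, hperM⟩
      rw [ConstOnCoset] at hc
      push Not at hc
      obtain ⟨g', hg'⟩ := hc
      obtain ⟨a0, a1⟩ := hΦ (r + Q • g + (Q * t) • g')
      obtain ⟨b0, b1⟩ := hΦ (r + Q • g)
      have ha : Φ (r + Q • g + (Q * t) • g') = 0 ∨ Φ (r + Q • g + (Q * t) • g') = 1 := by
        by_contra hcon
        push Not at hcon
        exact hg' (coe_addCircle_injOn b0 b1 (lt_of_le_of_ne a0 hcon.1.symm)
          (lt_of_le_of_ne a1 hcon.2) (hmod g').symm).symm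
      have hb : Φ (r + Q • g) = 0 ∨ Φ (r + Q • g) = 1 := by
        by_contra hcon
        push Not at hcon
        exact hg' (coe_addCircle_injOn a0 a1 (lt_of_le_of_ne b0 hcon.1.symm)
          (lt_of_le_of_ne b1 hcon.2) (hmod g'))
      intro ε hε
      rcases ha with ha | ha <;> rcases hb with hb | hb
      · exact absurd (ha.trans hb.symm) hg'
      · exact ⟨⟨g', by rw [ha]; exact hε⟩, 0, by rw [smul_zero, add_zero, hb]; linarith⟩
      · exact ⟨⟨0, by rw [smul_zero, add_zero, hb]; exact hε⟩, g', by rw [ha]; linarith⟩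
      · exact absurd (ha.trans hb.symm) hg'
  · right
    refine ⟨?_, H, rfl, hperM⟩
    have hu : ∀ k : ℤ, k ≠ 0 → invMean (fun n : ℕ => fourier k
        (Φ (r + Q • g + (Q * t) • n • e) : AddCircle (1 : ℝ))) = 0 := by
      intro k hk
      rw [← hmean k hk (N₀ * (1 : ℕ) * j₀) (N₀ * N * t)
        (Nat.mul_pos (Nat.mul_pos hN₀ hN) htpos)]
      congr 1; ext n
      have h1 : (Q * t) • n • e = ((N₀ * N * t * n : ℕ) : ℤ) • L • e := by
        rw [natCast_zsmul, ← mul_smul, ← mul_smul, hQ]; congr 1; ring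
      rw [h1, hj₀]
      refine congrArg (fun z : ℤ => fourier k (qs r z))
        (?_ : ((N₀ * N * t * n : ℕ) + N₀ * (1 : ℕ) * j₀ : ℤ) = _)
      push_cast; ring
    have hosc := fun a b ha hab hb => exists_mem_Ioo_of_invMean_fourier_eq_zero
      (u := fun n : ℕ => Φ (r + Q • g + (Q * t) • n • e)) (fun n => (hΦ _).1)
      (fun n => (hΦ _).2) hu (a := a) (b := b) ha hab hb
    intro ε hε
    constructor
    · obtain ⟨n, hn⟩ := hosc 0 (min ε 1) le_rfl (lt_min hε one_pos) (min_le_right _ _)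
      exact ⟨n • e, hn.2.trans_le (min_le_left _ _)⟩
    · obtain ⟨n, hn⟩ := hosc (max (1 - ε) 0) 1 (le_max_right _ _)
        (max_lt (by linarith) one_pos) le_rfl
      exact ⟨n • e, (le_max_left _ _).trans_lt hn.1⟩

end Oscillation

lemma exists_common_multiple {ι : Type*} (s : Finset ι) {P : ι → ℕ → Prop}
    (hP : ∀ i N t, P i N → P i (N * t)) (h : ∀ i ∈ s, ∃ N, 0 < N ∧ P i N) :
    ∃ N, 0 < N ∧ ∀ i ∈ s, P i N := by
  classical
  induction s using Finset.induction_on with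
  | empty => exact ⟨1, one_pos, by simp⟩
  | insert a s ha ih =>
    obtain ⟨N, hN, h1⟩ := ih fun i hi => h i (Finset.mem_insert_of_mem hi)
    obtain ⟨M, hM, h2⟩ := h a (Finset.mem_insert_self a s)
    refine ⟨N * M, Nat.mul_pos hN hM, fun i hi => ?_⟩
    rcases Finset.mem_insert.1 hi with rfl | hi
    · rw [mul_comm]; exact hP _ _ _ h2
    · exact hP _ _ _ (h1 i hi)

lemma exists_finset_residues (d Q : ℕ) (hQ : 0 < Q) :
    ∃ R : Finset (Fin d → ℤ), ∀ x, ∃ r ∈ R, ∃ g, x = r + Q • g := by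
  have hQ' : (0 : ℤ) < Q := by exact_mod_cast hQ
  refine ⟨Fintype.piFinset fun _ => Finset.Ico 0 (Q : ℤ), fun x => ⟨fun i => x i % Q, ?_,
    fun i => x i / Q, ?_⟩⟩
  · rw [Fintype.mem_piFinset]
    exact fun i => Finset.mem_Ico.2 ⟨Int.emod_nonneg _ hQ'.ne', Int.emod_lt_of_pos _ hQ'⟩
  · ext i
    simp [Int.emod_add_mul_ediv]

/-! ### Hyperplane sums and the backward induction -/

section Structure

variable {k : ℕ} {F : Fin k → Finset (Fin (k + 1) → ℤ)} {q : ℕ} {f : (Fin (k + 1) → ℤ) → ℝ}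

lemma update_mem_nonzeroTuples {v : Fin k → Fin (k + 1) → ℤ} (hv : v ∈ nonzeroTuples F) (i : Fin k)
    {u : Fin (k + 1) → ℤ} (hu : u ∈ (F i).erase 0) :
    Function.update v i u ∈ nonzeroTuples F := by
  rw [nonzeroTuples, Fintype.mem_piFinset] at hv ⊢
  intro i'
  rcases eq_or_ne i' i with rfl | hne
  · simpa using hu
  · rw [Function.update_of_ne hne]; exact hv i'

open Classical in
/-- The sum of the full iterated averages over all tuples that span a given hyperplane. -/
noncomputable def hyperplaneSum (F : Fin k → Finset (Fin (k + 1) → ℤ)) (q : ℕ)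
    (f : (Fin (k + 1) → ℤ) → ℝ) (H : AddSubgroup (Fin (k + 1) → ℤ)) (x : Fin (k + 1) → ℤ) : ℝ :=
  ∑ w ∈ nonzeroTuples F with saturation w = H, iterAvg q f w k x

-- By (⋆) a tuple with this hyperplane is determined by its entry at l, so the hyperplane sum is a
-- partial sum of a single step of the recursion.
open Classical in
lemma sum_update_eq_hyperplaneSum {l : Fin k}
    (hstar : ∀ v ∈ nonzeroTuples F, ∀ w ∈ nonzeroTuples F, saturation v = saturation w →
      ∀ i, i ≠ l → v i = w i)
    {v : Fin k → Fin (k + 1) → ℤ} (hv : v ∈ nonzeroTuples F) {u₀ : Fin (k + 1) → ℤ}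
    (hu₀ : u₀ ∈ (F l).erase 0) (x : Fin (k + 1) → ℤ) :
    ∑ u ∈ (F l).erase 0 with
        saturation (Function.update v l u) = saturation (Function.update v l u₀),
      iterAvg q f (Function.update v l u) k x
      = hyperplaneSum F q f (saturation (Function.update v l u₀)) x := by
  have hup : ∀ w ∈ nonzeroTuples F, saturation w = saturation (Function.update v l u₀) →
      Function.update v l (w l) = w := by
    intro w hw hs
    ext1 i
    rcases eq_or_ne i l with rfl | hne
    · simp
    · rw [hstar w hw _ (update_mem_nonzeroTuples hv l hu₀) hs i hne,
        Function.update_of_ne hne, Function.update_of_ne hne]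
  refine Finset.sum_nbij' (fun u => Function.update v l u) (fun w => w l) ?_ ?_ ?_ ?_ ?_
  · intro u hu
    rw [Finset.mem_filter] at hu ⊢
    exact ⟨update_mem_nonzeroTuples hv l hu.1, hu.2⟩
  · intro w hw
    rw [Finset.mem_filter] at hw ⊢
    refine ⟨Fintype.mem_piFinset.1 hw.1 l, ?_⟩
    rw [hup w hw.1 hw.2]; exact hw.2
  · intro u _; simp
  · intro w hw
    rw [Finset.mem_filter] at hw
    exact hup w hw.1 hw.2
  · intro u _; rfl

lemma hyperplaneSum_mem_Icc (hf : ∀ x, f x ∈ Set.Icc (0 : ℝ) 1)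
    (hF : ∀ i (n : ℕ) x, ∑ u ∈ F i, f (x - (1 + n * q) • u) = 1) (h0 : ∀ i, 0 ∈ F i)
    {l : Fin k} (hl : (l : ℕ) + 1 = k)
    (hstar : ∀ v ∈ nonzeroTuples F, ∀ w ∈ nonzeroTuples F, saturation v = saturation w →
      ∀ i, i ≠ l → v i = w i)
    {v : Fin k → Fin (k + 1) → ℤ} (hv : v ∈ nonzeroTuples F) (x : Fin (k + 1) → ℤ) :
    hyperplaneSum F q f (saturation v) x ∈ Set.Icc (0 : ℝ) 1 := by
  classical
  refine ⟨Finset.sum_nonneg fun w _ => (iterAvg_mem_Icc hf w k x).1, ?_⟩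
  have h1 := sum_update_eq_hyperplaneSum (q := q) (f := f) hstar hv
    (Fintype.mem_piFinset.1 hv l) x
  rw [Function.update_eq_self] at h1
  rw [← h1]
  refine (Finset.sum_le_sum_of_subset_of_nonneg (Finset.filter_subset _ _)
    fun u _ _ => (iterAvg_mem_Icc hf _ k x).1).trans ?_
  have h2 := iterAvg_eq_one_sub hf hF h0 v l x
  rw [hl] at h2
  have h3 := (iterAvg_mem_Icc (q := q) hf v l x).1
  linarith

/-- The subgroups generated, up to saturation, by the tuples that agree with `v` on the first `j`
entries. -/
def extensionHyperplanes (F : Fin k → Finset (Fin (k + 1) → ℤ)) (v : Fin k → Fin (k + 1) → ℤ)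
    (j : ℕ) : Set (AddSubgroup (Fin (k + 1) → ℤ)) :=
  {H | ∃ w ∈ nonzeroTuples F, (∀ i : Fin k, (i : ℕ) < j → w i = v i) ∧ saturation w = H}

lemma exists_transversality_constant
    (hli : ∀ v ∈ nonzeroTuples F, LinearIndependent ℤ v) :
    ∃ K : ℕ, 0 < K ∧ ∀ v ∈ nonzeroTuples F, ∀ w ∈ nonzeroTuples F, saturation v ≠ saturation w →
      ∀ g, ∃ a ∈ saturation v, ∃ b ∈ saturation w, K • g = a + b := by
  obtain ⟨K, hK, h⟩ := exists_common_multiple (nonzeroTuples F ×ˢ nonzeroTuples F)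
    (P := fun p K => saturation p.1 ≠ saturation p.2 →
      ∀ g, ∃ a ∈ saturation p.1, ∃ b ∈ saturation p.2, K • g = a + b)
    (fun p N t hp hne g => by
      obtain ⟨a, ha, b, hb, hab⟩ := hp hne (t • g)
      exact ⟨a, ha, b, hb, by rw [mul_smul, hab]⟩)
    (fun p hp => by
      rw [Finset.mem_product] at hp
      by_cases hne : saturation p.1 = saturation p.2
      · exact ⟨1, one_pos, fun h => absurd hne h⟩
      · obtain ⟨K, hK, h⟩ := exists_nsmul_eq_add_of_saturation_ne (hli _ hp.1) (hli _ hp.2) hne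
        exact ⟨K, hK, fun _ => h⟩)
  exact ⟨K, hK, fun v hv w hw => h (v, w) (Finset.mem_product.2 ⟨hv, hw⟩)⟩

lemma exists_period_constant (hf : ∀ x, f x ∈ Set.Icc (0 : ℝ) 1) (hq : 0 < q)
    (hli : ∀ v ∈ nonzeroTuples F, LinearIndependent ℤ v) :
    ∃ N : ℕ, 0 < N ∧ ∀ v ∈ nonzeroTuples F, ∀ h ∈ saturation v, ∀ x,
      iterAvg q f v k (x + N • h) = iterAvg q f v k x :=
  exists_common_multiple (nonzeroTuples F)
    (P := fun v N => ∀ h ∈ saturation v, ∀ x, iterAvg q f v k (x + N • h) = iterAvg q f v k x)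
    (fun v N t hp h hh x => by rw [mul_smul]; exact hp _ (AddSubgroup.nsmul_mem _ hh t) x)
    fun v hv => exists_forall_add_nsmul_saturation_eq (hli v hv) hq
      fun i x => iterAvg_add_nsmul hf v i.2 x

/-- Modulo 1 the sums over all hyperplanes add up to a constant, and the hyperplanes in I are
transversal to that of v. -/
lemma exists_constOrOsc_hyperplaneSum (hf : ∀ x, f x = 0 ∨ f x = 1) (hq : 0 < q)
    (hF : ∀ i (n : ℕ) x, ∑ u ∈ F i, f (x - (1 + n * q) • u) = 1) (h0 : ∀ i, 0 ∈ F i)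
    {l : Fin k} (hl : (l : ℕ) + 1 = k) (hli : ∀ v ∈ nonzeroTuples F, LinearIndependent ℤ v)
    (hstar : ∀ v ∈ nonzeroTuples F, ∀ w ∈ nonzeroTuples F, saturation v = saturation w →
      ∀ i, i ≠ l → v i = w i)
    {v : Fin k → Fin (k + 1) → ℤ} (hv : v ∈ nonzeroTuples F) :
    ∃ N : ℕ, 0 < N ∧ ConstOrOsc N {saturation v} (hyperplaneSum F q f (saturation v)) := by
  classical
  have hf' : ∀ x, f x ∈ Set.Icc (0 : ℝ) 1 := fun x => by rcases hf x with h | h <;> simp [h]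
  obtain ⟨N₀, hN₀, hper⟩ := exists_period_constant (F := F) hf' hq hli
  obtain ⟨K, hK, htrans⟩ := exists_transversality_constant hli
  have hperH : ∀ H, ∀ h ∈ H, ∀ x,
      hyperplaneSum F q f H (x + N₀ • h) = hyperplaneSum F q f H x := by
    intro H h hh x
    refine Finset.sum_congr rfl fun w hw => ?_
    rw [Finset.mem_filter] at hw
    exact hper w hw.1 h (hw.2 ▸ hh) x
  obtain ⟨c, hc⟩ := exists_sum_iterAvg_eq_add_int hf hF h0 v
  set I := ((nonzeroTuples F).image saturation).erase (saturation v) with hI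
  have htotal : ∀ x, hyperplaneSum F q f (saturation v) x + ∑ H ∈ I, hyperplaneSum F q f H x
      = ∑ w ∈ nonzeroTuples F, iterAvg q f w k x := by
    intro x
    rw [hI, Finset.add_sum_erase _ (fun H => hyperplaneSum F q f H x)
      (Finset.mem_image_of_mem _ hv)]
    exact Finset.sum_fiberwise_of_maps_to (fun w hw => Finset.mem_image_of_mem _ hw) _
  have hcirc : ∀ x, (hyperplaneSum F q f (saturation v) x : AddCircle (1 : ℝ)) +
      ∑ H ∈ I, (hyperplaneSum F q f H x : AddCircle (1 : ℝ)) = (c : AddCircle (1 : ℝ)) := by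
    intro x
    obtain ⟨n, hn⟩ := hc x
    have h1 : ((∑ H ∈ I, hyperplaneSum F q f H x : ℝ) : AddCircle (1 : ℝ))
        = ∑ H ∈ I, (hyperplaneSum F q f H x : AddCircle (1 : ℝ)) :=
      map_sum (QuotientAddGroup.mk' (AddSubgroup.zmultiples (1 : ℝ))) _ _
    rw [← h1, ← AddCircle.coe_add, htotal, hn, AddCircle.coe_add]
    have h2 : ((n : ℝ) : AddCircle (1 : ℝ)) = 0 := by
      rw [AddCircle.coe_eq_zero_iff]; exact ⟨n, by simp⟩
    rw [h2, add_zero]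
  obtain ⟨e, he⟩ := exists_notMem_saturation v
  obtain ⟨N, hN, hNe⟩ := exists_nsmul_eq_add_of_notMem (hli v hv) he
  refine constOrOsc_of_isPolySeq (fun Q hQ => exists_finset_residues (k + 1) Q hQ)
    (hyperplaneSum_mem_Icc hf' hF h0 hl hstar hv) hN₀ (hperH _) hN (e := e) (fun g => ?_)
    (L := N₀ * K) (m := I.card) (Nat.mul_pos hN₀ hK) fun x => ?_
  · obtain ⟨s, hs, j, hj⟩ := hNe g
    exact ⟨s, closure_le_saturation v hs, j, hj⟩
  · refine isPolySeq_of_add_sum_const (H := saturation v) I id (fun H hH => ?_)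
      (p := fun x => (hyperplaneSum F q f (saturation v) x : AddCircle (1 : ℝ)))
      (fun h hh x => congrArg _ (hperH _ h hh x))
      (p' := fun H x => (hyperplaneSum F q f H x : AddCircle (1 : ℝ)))
      (fun H _ h hh x => congrArg _ (hperH H h hh x)) hcirc x e
    rw [hI, Finset.mem_erase, Finset.mem_image] at hH
    obtain ⟨hne, w, hw, rfl⟩ := hH
    exact htrans v hv w hw hne.symm

/-- Backward induction on j. At j = l different choices of the last entry may give one hyperplane,
so the terms are grouped into hyperplane sums; below l, (⋆) keeps the hyperplanes of different
choices apart. -/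
lemma exists_constOrOsc_iterAvg (hf : ∀ x, f x = 0 ∨ f x = 1) (hq : 0 < q)
    (hF : ∀ i (n : ℕ) x, ∑ u ∈ F i, f (x - (1 + n * q) • u) = 1) (h0 : ∀ i, 0 ∈ F i)
    {l : Fin k} (hl : (l : ℕ) + 1 = k) (hli : ∀ v ∈ nonzeroTuples F, LinearIndependent ℤ v)
    (hstar : ∀ v ∈ nonzeroTuples F, ∀ w ∈ nonzeroTuples F, saturation v = saturation w →
      ∀ i, i ≠ l → v i = w i) {j : ℕ} (hj : j ≤ l) :
    ∃ N : ℕ, 0 < N ∧ ∀ v ∈ nonzeroTuples F,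
      ConstOrOsc N (extensionHyperplanes F v j) (iterAvg q f v j) := by
  classical
  have hf' : ∀ x, f x ∈ Set.Icc (0 : ℝ) 1 := fun x => by rcases hf x with h | h <;> simp [h]
  obtain ⟨K, hK, htrans⟩ := exists_transversality_constant hli
  induction hj using Nat.decreasingInduction with
  | self =>
    obtain ⟨N, hN, hosc⟩ := exists_common_multiple (nonzeroTuples F)
      (P := fun v N => ConstOrOsc N {saturation v} (hyperplaneSum F q f (saturation v)))
      (fun v N t h => h.mono (Dvd.intro t rfl) subset_rfl)
      fun v hv => exists_constOrOsc_hyperplaneSum hf hq hF h0 hl hli hstar hv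
    refine ⟨K * N, Nat.mul_pos hK hN, fun v hv => ?_⟩
    set s := ((F l).erase 0).image fun u => saturation (Function.update v l u) with hs
    have hmem : ∀ H ∈ s, ∃ w ∈ nonzeroTuples F, (∀ i : Fin k, (i : ℕ) < l → w i = v i) ∧
        saturation w = H := by
      intro H hH
      obtain ⟨u, hu, rfl⟩ := Finset.mem_image.1 hH
      exact ⟨_, update_mem_nonzeroTuples hv l hu,
        fun i hi => Function.update_of_ne (Fin.ne_of_lt hi) _ _, rfl⟩
    have hrec : ∀ x, iterAvg q f v l x = 1 - ∑ H ∈ s, hyperplaneSum F q f H x := by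
      intro x
      rw [iterAvg_eq_one_sub hf' hF h0 v l x, hl, hs, ← Finset.sum_fiberwise_of_maps_to
        (fun u hu => Finset.mem_image_of_mem
          (fun u => saturation (Function.update v l u)) hu)]
      congr 1
      refine Finset.sum_congr rfl fun H hH => ?_
      obtain ⟨u, hu, rfl⟩ := Finset.mem_image.1 hH
      exact sum_update_eq_hyperplaneSum hstar hv hu x
    have hcomb := constOrOsc_one_sub_sum (s := s) (u := hyperplaneSum F q f) (K := K) hN
      (S := fun H => {H})
      (fun H hH x => by
        obtain ⟨w, hw, -, rfl⟩ := hmem H hH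
        exact (hyperplaneSum_mem_Icc hf' hF h0 hl hstar hw x).1)
      (fun x => by
        have h1 := (iterAvg_mem_Icc (q := q) hf' v l x).1
        rw [hrec x] at h1
        linarith)
      (fun H hH => by
        obtain ⟨w, hw, -, rfl⟩ := hmem H hH
        exact hosc w hw)
      (by
        rintro H hH H' hH' hne _ rfl _ rfl
        obtain ⟨w, hw, -, rfl⟩ := hmem _ hH
        obtain ⟨w', hw', -, rfl⟩ := hmem _ hH'
        exact htrans w hw w' hw' hne)
    rw [← funext hrec] at hcomb
    refine hcomb.mono dvd_rfl ?_
    intro H hH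
    simp only [Set.mem_iUnion, Set.mem_singleton_iff] at hH
    obtain ⟨H', hH', rfl⟩ := hH
    exact hmem H hH'
  | of_succ j hjl ih =>
    obtain ⟨N, hN, hosc⟩ := ih
    refine ⟨K * N, Nat.mul_pos hK hN, fun v hv => ?_⟩
    set i : Fin k := ⟨j, hjl.trans l.2⟩ with hi
    have hil : i ≠ l := Fin.ne_of_lt hjl
    have hrec := iterAvg_eq_one_sub hf' hF h0 v i
    have hcomb := constOrOsc_one_sub_sum (s := (F i).erase 0)
      (u := fun u => iterAvg q f (Function.update v i u) (j + 1)) (K := K) hN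
      (S := fun u => extensionHyperplanes F (Function.update v i u) (j + 1))
      (fun u _ x => (iterAvg_mem_Icc hf' _ _ x).1)
      (fun x => by
        have h1 := (iterAvg_mem_Icc (q := q) hf' v i x).1
        rw [hrec x] at h1
        linarith)
      (fun u hu => hosc _ (update_mem_nonzeroTuples hv i hu))
      (by
        rintro u hu u' hu' hne _ ⟨w, hw, hwu, rfl⟩ _ ⟨w', hw', hwu', rfl⟩
        -- Equal hyperplanes would force w and w' to agree at i ≠ l, where their entries are u and
        -- u'.
        refine htrans w hw w' hw' fun hsat => hne ?_
        have h1 := hwu i j.lt_succ_self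
        have h2 := hwu' i j.lt_succ_self
        rw [Function.update_self] at h1 h2
        rw [← h1, ← h2]
        exact hstar w hw w' hw' hsat i hil)
    rw [← funext hrec] at hcomb
    refine hcomb.mono dvd_rfl ?_
    intro H hH
    simp only [Set.mem_iUnion] at hH
    obtain ⟨u, hu, w, hw, hwu, rfl⟩ := hH
    refine ⟨w, hw, fun i' hi' => ?_, rfl⟩
    rw [hwu i' (hi'.trans j.lt_succ_self), Function.update_of_ne]
    exact Fin.ne_of_lt hi'

end Structure

/-! ### From co-tiles to piecewise periodicity -/

section Cotile

lemma IsKPeriodic.isPiecewiseKPeriodic {d k : ℕ} {A : Set (Fin d → ℤ)} (h : IsKPeriodic k A) :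
    IsPiecewiseKPeriodic k A :=
  ⟨1, fun _ => A, fun i j hij => absurd (Subsingleton.elim i j) hij, Set.iUnion_const A, fun _ => h⟩

lemma isKPeriodic_univ (d k : ℕ) (hk : k ≤ d) : IsKPeriodic k (Set.univ : Set (Fin d → ℤ)) := by
  refine ⟨⊤, ?_, by simp⟩
  have h := finrank_top ℤ (Fin d → ℤ)
  rw [Module.finrank_fin_fun] at h
  exact hk.trans h.ge

lemma sum_indicator_eq_one_of_isComplement {G : Type*} [AddCommGroup G] {s : Finset G} {A : Set G}
    (h : AddSubgroup.IsComplement (s : Set G) A) (x : G) :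
    ∑ u ∈ s, A.indicator (1 : G → ℕ) (x - u) = 1 := by
  classical
  obtain ⟨⟨⟨u, hu⟩, ⟨a, ha⟩⟩, hx, huniq⟩ := h.existsUnique x
  simp only at hx
  have hmem : ∀ u' ∈ s, x - u' ∈ A → u' = u := by
    intro u' hu' ha'
    have := huniq (⟨u', hu'⟩, ⟨x - u', ha'⟩) (by simp)
    exact congrArg (fun p => (p.1 : G)) this
  rw [Finset.sum_eq_single_of_mem u hu]
  · rw [Set.indicator_of_mem]
    · rfl
    · rwa [← hx, add_sub_cancel_left]
  · intro u' hu' hne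
    exact Set.indicator_of_notMem (fun ha' => hne (hmem u' hu' ha')) _

/-- The pieces are the intersections of A with the residue classes modulo N. Each may have its own
L, and translations by N • L preserve its class. -/
lemma isPiecewiseKPeriodic_of_cosets {d k N : ℕ} (hN : 0 < N) {A : Set (Fin d → ℤ)}
    (h : ∀ x, ∃ L : AddSubgroup (Fin d → ℤ), k ≤ Module.finrank ℤ (L.map (nsmulAddMonoidHom N)) ∧
      ∀ g, ∀ h ∈ L, x + N • g + N • h ∈ A ↔ x + N • g ∈ A) : IsPiecewiseKPeriodic k A := by
  have : NeZero N := ⟨hN.ne'⟩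
  set r : (Fin d → ℤ) → Fin d → ZMod N := fun x i => (x i : ZMod N) with hr
  have hrx : ∀ x y, r x = r y → ∃ g, y = x + N • g := by
    intro x y hxy
    have : ∀ i, ∃ c, y i - x i = N * c := fun i =>
      (ZMod.intCast_eq_intCast_iff_dvd_sub _ _ _).1 (congrFun hxy i)
    choose g hg using this
    refine ⟨g, ?_⟩
    ext i
    simp [← hg]
  have hradd : ∀ x g, r (x + N • g) = r x := by
    intro x g
    ext i
    simp [hr]
  set e := Fintype.equivFin (Fin d → ZMod N)
  refine ⟨Fintype.card (Fin d → ZMod N), fun j => A ∩ {x | r x = e.symm j}, ?_, ?_, fun j => ?_⟩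
  · intro i j hij
    rw [Set.disjoint_left]
    rintro x ⟨-, hx⟩ ⟨-, hx'⟩
    exact hij (e.symm.injective (hx.symm.trans hx'))
  · rw [← Set.inter_iUnion, Set.inter_eq_left]
    intro x _
    exact Set.mem_iUnion.2 ⟨e (r x), by simp⟩
  · have hsurj : ∃ x, r x = e.symm j :=
      ⟨fun i => ((e.symm j i).val : ℤ), by ext i; simp [hr]⟩
    obtain ⟨x, hx⟩ := hsurj
    obtain ⟨L, hL, hper⟩ := h x
    refine ⟨_, hL, Set.Subset.antisymm ?_ ?_⟩
    · rintro _ ⟨y, ⟨hyA, hyr⟩, _, ⟨h, hh, rfl⟩, rfl⟩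
      obtain ⟨g, rfl⟩ := hrx x y (hx.trans hyr.symm)
      refine ⟨(hper g h hh).2 hyA, ?_⟩
      exact (hradd _ h).trans hyr
    · intro y hy
      exact ⟨y, hy, 0, zero_mem _, add_zero y⟩

end Cotile

theorem theorem1p5 (d : ℕ) (hd : 2 ≤ d) (F : Fin (d - 1) → Finset (Fin d → ℤ))
    (hF : PropertyStar F) (A : Set (Fin d → ℤ)) (hA : IsJointCotile F A) :
    IsPiecewiseKPeriodic (d - 1) A := by
  obtain ⟨k, rfl⟩ : ∃ k, d = k + 1 := ⟨d - 1, by omega⟩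
  change Fin k → Finset (Fin (k + 1) → ℤ) at F
  change IsPiecewiseKPeriodic k A
  obtain ⟨⟨h0, hindep⟩, hspan⟩ := hF
  have hmemT : ∀ v : Fin k → Fin (k + 1) → ℤ, v ∈ nonzeroTuples F ↔ v ∈ starTuples F := fun v => by
    simp [nonzeroTuples, starTuples, and_comm]
  rcases (nonzeroTuples F).eq_empty_or_nonempty with hempty | ⟨v₀, hv₀⟩
  -- Without nonzero tuples some tile is {0}, and then A is the whole group.
  · have hi : ∃ i, (F i).erase 0 = ∅ := by
      by_contra hne
      push Not at hne
      exact (Fintype.piFinset_nonempty.2 hne).ne_empty hempty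
    obtain ⟨i, hi⟩ := hi
    have hAu : A = Set.univ := by
      refine Set.eq_univ_of_forall fun x => ?_
      have := sum_indicator_eq_one_of_isComplement (hA i) x
      rw [← Finset.sum_erase_add _ _ (h0 i), hi] at this
      by_contra hx
      simp [hx] at this
    rw [hAu]
    exact (isKPeriodic_univ _ _ k.le_succ).isPiecewiseKPeriodic
  -- Every 1 + nq is then coprime to every tile size, as dilation requires.
  set q : ℕ := ∏ i, (F i).card with hqdef
  have hq : 0 < q := Finset.prod_pos fun i _ => Finset.card_pos.2 ⟨0, h0 i⟩
  set f : (Fin (k + 1) → ℤ) → ℝ := fun x => (A.indicator (1 : (Fin (k + 1) → ℤ) → ℕ) x : ℕ)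
    with hfdef
  have hf : ∀ x, f x = 0 ∨ f x = 1 := fun x => by
    by_cases hx : x ∈ A <;> simp [hfdef, hx]
  have hfA : ∀ x, x ∈ A ↔ f x = 1 := fun x => by
    by_cases hx : x ∈ A <;> simp [hfdef, hx]
  have htile : ∀ i (n : ℕ) x, ∑ u ∈ F i, f (x - (1 + n * q) • u) = 1 := by
    intro i n x
    have hcop : (1 + n * q).Coprime (F i).card := by
      obtain ⟨m, hm⟩ : (F i).card ∣ q := Finset.dvd_prod_of_mem _ (Finset.mem_univ i)
      rw [hm, mul_left_comm, mul_comm]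
      simp
    have := sum_translate_dilate (F i) id (A.indicator (1 : (Fin (k + 1) → ℤ) → ℕ))
      (sum_indicator_eq_one_of_isComplement (hA i)) (1 + n * q) (by omega) hcop x
    simp only [hfdef]
    exact_mod_cast this
  have hli : ∀ v ∈ nonzeroTuples F, LinearIndependent ℤ v := fun v hv =>
    hindep v ((hmemT v).1 hv)
  have hk : k - 1 < k := by omega
  have hstar : ∀ v ∈ nonzeroTuples F, ∀ w ∈ nonzeroTuples F, saturation v = saturation w →
      ∀ i, i ≠ (⟨k - 1, hk⟩ : Fin k) → v i = w i := fun v hv w hw hvw i hi =>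
    hspan v ((hmemT v).1 hv) w ((hmemT w).1 hw) (realSpan_eq_of_saturation_eq hvw) i (by
      have := Fin.val_ne_of_ne hi
      have := i.2
      simp only at *
      omega)
  obtain ⟨N, hN, hosc⟩ := exists_constOrOsc_iterAvg hf hq htile h0 (l := ⟨k - 1, hk⟩)
    (Nat.sub_add_cancel (by omega)) hli hstar (Nat.zero_le _)
  refine isPiecewiseKPeriodic_of_cosets hN fun x => ?_
  -- At level 0 the iterated average is f itself. If f is constant on the coset any hyperplane
  -- lattice will do, for instance that of v₀.
  rcases hosc v₀ hv₀ N hN dvd_rfl x with hc | ⟨-, H, ⟨w, hw, -, rfl⟩, hper⟩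
  · refine ⟨saturation v₀, le_finrank_map_saturation (hli v₀ hv₀) hN, fun g h _ => ?_⟩
    have h1 := hc (g + h)
    have h2 := hc g
    simp only [iterAvg] at h1 h2
    rw [hfA, hfA, h2, ← h1, smul_add, add_assoc]
  · refine ⟨saturation w, le_finrank_map_saturation (hli w hw) hN, fun g h hh => ?_⟩
    have h1 := hper g h hh
    simp only [iterAvg] at h1
    rw [hfA, hfA, h1]
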